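/- Let $K$ be an infinite field, $n\ge 2$, $R=K[x_1,\dots,x_n]$ with its standard grading, and $\mathfrak m=(x_1,\dots,x_n)$. For a homogeneous ideal $I$ of $R$ let $I_j$ be the $K$-vector space of forms of degree $j$ in $I$, let $I_{\langle j\rangle}$ be the ideal generated by $I_j$, let $o(I)$ be the least degree of a non-zero element of $I$ (for $I\ne 0$), let $I^{\mathrm{sat}}=\bigcup_k (I:\mathfrak m^k)$, and let $\operatorname{reg}(I)=\max\{j-i:\beta_{ij}(I)\neq 0\}$ (for $I\neq 0$) be the Castelnuovo–Mumford regularity, where $\beta_{ij}(I)=\dim_K\operatorname{Tor}^R_i(I,K)_j$. A homogeneous ideal $I$ is componentwise linear if for every $d\in\mathbb N$ the ideal $I_{\langle d\rangle}$ has a linear resolution, i.e. is zero or satisfies $\operatorname{reg}(I_{\langle d\rangle})=o(I_{\langle d\rangle})$. Let $\mathcal C$ be the set of homogeneous ideals $I$ of $R$ of finite colength (including $I=R$) that are componentwise linear and satisfy $I+(\ell)=\mathfrak m^{o(I)}+(\ell)$ for some non-zero linear form $\ell$. Let $\mathcal A$ be the set of families $\mathcal Q=\{Q_j\}_{j\in\mathbb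 N}$ of homogeneous ideals of $R$ such that $Q_j\subseteq Q_{j+1}$ for all $j$, $Q_j=R$ for all $j\gg 0$, and whenever $Q_j\ne R$ the ideal $Q_j$ is saturated (that is, $Q_j^{\mathrm{sat}}=Q_j$) and $\dim R/Q_j=1$. Here $\mathbb N=\{0,1,2,\dots\}$. Then there are well-defined, mutually inverse maps $$\varphi:\mathcal A\times\mathbb N\to\mathcal C,\qquad \psi:\mathcal C\to\mathcal A\times\mathbb N$$ given by $$\varphi(\mathcal Q,k)=\bigoplus_{j\in\mathbb N}(Q_j)_{\operatorname{reg}(Q_0)+k+j},\qquad \psi(I)=\bigl(\{Q_j(I)\}_{j\in\mathbb N},\ o(I)-\operatorname{reg}(Q_0(I))\bigr),$$ where $Q_j(I)=(I_{\langle o(I)+j\rangle})^{\mathrm{sat}}$. In particular $\varphi(\mathcal Q,k)$ is an ideal of $R$ belonging to $\mathcal C$, the family $\{Q_j(I)\}_j$ belongs to $\mathcal A$, and $o(I)\ge\operatorname{reg}(Q_0(I))$. -/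

import Mathlib

open MvPolynomial

noncomputable section

namespace GradedIdeal

attribute [local instance] MvPolynomial.gradedAlgebra

variable {K : Type*} [Field K] {n : ℕ}

/-- The ideal `I` of `K[x_1, …, x_n]` is homogeneous for the standard grading. -/
def Homog (I : Ideal (MvPolynomial (Fin n) K)) : Prop :=
  I.IsHomogeneous (homogeneousSubmodule (Fin n) K)

/-- `I_j`: the `K`-vector space of the forms of degree `j` in `I`. -/
def component (I : Ideal (MvPolynomial (Fin n) K)) (j : ℕ) :
    Submodule K (MvPolynomial (Fin n) K) :=
  I.restrictScalars K ⊓ homogeneousSubmodule (Fin n) K j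

/-- `I_⟨j⟩`: the ideal generated by the forms of degree `j` in `I`. -/
def componentIdeal (I : Ideal (MvPolynomial (Fin n) K)) (j : ℕ) :
    Ideal (MvPolynomial (Fin n) K) :=
  Ideal.span (component I j : Set (MvPolynomial (Fin n) K))

/-- `o(I)`: the least degree of a non-zero form in the (non-zero, homogeneous) ideal `I`. -/
def initialDegree (I : Ideal (MvPolynomial (Fin n) K)) : ℕ :=
  sInf {d | component I d ≠ ⊥}

/-- The saturation `⋃_k (I : 𝔪^k)` with respect to `𝔪 = (x_1, …, x_n)`.  The ideals `I : 𝔪^k`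
increase with `k`, so their supremum is their union. -/
def saturation (I : Ideal (MvPolynomial (Fin n) K)) : Ideal (MvPolynomial (Fin n) K) :=
  ⨆ k : ℕ, I.colon ((idealOfVars (Fin n) K ^ k : Ideal (MvPolynomial (Fin n) K)) :
    Set (MvPolynomial (Fin n) K))

/-- The Koszul differential of `x_1, …, x_n` over `K[x_1, …, x_n]`.  The function `c` stands for
`∑_S c_S e_S`, and `e_S` is sent to `∑_{a ∈ S} (-1)^{#{b ∈ S : b < a}} x_a e_{S \ {a}}`. -/
def koszulD (K : Type*) [Field K] (n : ℕ) :
    (Finset (Fin n) → MvPolynomial (Fin n) K) →ₗ[K]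
      (Finset (Fin n) → MvPolynomial (Fin n) K) where
  toFun c T := ∑ a ∈ Tᶜ, (-1) ^ (T.filter (fun b => b < a)).card * X a * c (insert a T)
  map_add' c c' := by
    funext T
    simp only [Pi.add_apply, mul_add, Finset.sum_add_distrib]
  map_smul' r c := by
    funext T
    simp only [Pi.smul_apply, mul_smul_comm, Finset.smul_sum, RingHom.id_apply]

/-- The part of homological degree `i` and internal degree `j` of the Koszul complex
`I ⊗ K(x_1, …, x_n)`: the elements `∑_{#S = i} c_S e_S` with each `c_S` in `I`, homogeneous of
degree `j - i` (each `e_S` has degree `i`, so the part is zero if `j < i`). -/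
def koszulChains (I : Ideal (MvPolynomial (Fin n) K)) (i j : ℕ) :
    Submodule K (Finset (Fin n) → MvPolynomial (Fin n) K) :=
  Submodule.pi Set.univ fun S =>
    if S.card = i then
      I.restrictScalars K ⊓ restrictSupport K {m : Fin n →₀ ℕ | m.degree + i = j}
    else ⊥

/-- The cycles in homological degree `i` and internal degree `j`. -/
def koszulCycles (I : Ideal (MvPolynomial (Fin n) K)) (i j : ℕ) :
    Submodule K (Finset (Fin n) → MvPolynomial (Fin n) K) :=
  koszulChains I i j ⊓ LinearMap.ker (koszulD K n)

/-- The boundaries in homological degree `i` and internal degree `j`. -/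
def koszulBoundaries (I : Ideal (MvPolynomial (Fin n) K)) (i j : ℕ) :
    Submodule K (Finset (Fin n) → MvPolynomial (Fin n) K) :=
  (koszulChains I (i + 1) j).map (koszulD K n)

/-- The graded Betti number `β_{ij}(I) = dim_K Tor_i(I, K)_j` of the module `I`, where `Tor` is
computed by the Koszul complex, the minimal graded free resolution of `K`. -/
def gradedBetti (I : Ideal (MvPolynomial (Fin n) K)) (i j : ℕ) : ℕ :=
  Module.finrank K (koszulCycles I i j ⧸ (koszulBoundaries I i j).submoduleOf (koszulCycles I i j))

/-- The Castelnuovo–Mumford regularity `max {j - i : β_{ij}(I) ≠ 0}` of a non-zero homogeneous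
ideal.  (`β_{ij}(I) ≠ 0` forces `i ≤ j`, so the differences are natural numbers.) -/
def regularity (I : Ideal (MvPolynomial (Fin n) K)) : ℕ :=
  sSup {r | ∃ i j : ℕ, gradedBetti I i j ≠ 0 ∧ r + i = j}

/-- The ideal has a linear resolution; the zero ideal has one by convention. -/
def HasLinearResolution (I : Ideal (MvPolynomial (Fin n) K)) : Prop :=
  I = ⊥ ∨ regularity I = initialDegree I

def ComponentwiseLinear (I : Ideal (MvPolynomial (Fin n) K)) : Prop :=
  ∀ d : ℕ, HasLinearResolution (componentIdeal I d)

/-- The class `𝒞`: homogeneous ideals of finite colength that satisfy `I + (ℓ) = 𝔪^{o(I)} + (ℓ)`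
for some non-zero linear form `ℓ`, and that are componentwise linear. -/
def classC (K : Type*) [Field K] (n : ℕ) : Set (Ideal (MvPolynomial (Fin n) K)) :=
  {I | Homog I ∧ Module.Finite K (MvPolynomial (Fin n) K ⧸ I) ∧
    (∃ ℓ : MvPolynomial (Fin n) K, ℓ.IsHomogeneous 1 ∧ ℓ ≠ 0 ∧
      I ⊔ Ideal.span {ℓ} = idealOfVars (Fin n) K ^ initialDegree I ⊔ Ideal.span {ℓ}) ∧
    ComponentwiseLinear I}

/-- The set `𝒜` of the increasing families `(Q_j)_{j ∈ ℕ}` of homogeneous ideals, with `Q_j = R`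
for large `j`, such that every `Q_j ≠ R` is saturated with `dim R / Q_j = 1`. -/
def familiesA (K : Type*) [Field K] (n : ℕ) : Set (ℕ → Ideal (MvPolynomial (Fin n) K)) :=
  {Q | (∀ j, Homog (Q j)) ∧ (∀ j, Q j ≤ Q (j + 1)) ∧ (∃ N, ∀ j, N ≤ j → Q j = ⊤) ∧
    ∀ j, Q j ≠ ⊤ →
      saturation (Q j) = Q j ∧ ringKrullDim (MvPolynomial (Fin n) K ⧸ Q j) = 1}

/-- `Q_j(I)`: the saturation of `I_⟨o(I) + j⟩`. -/
def satFamily (I : Ideal (MvPolynomial (Fin n) K)) (j : ℕ) : Ideal (MvPolynomial (Fin n) K) :=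
  saturation (componentIdeal I (initialDegree I + j))

/-- The vector space `⊕_{j ∈ ℕ} (Q_j)_{d_0 + k + j}` with `d_0 = reg(Q_0)`, inside
`K[x_1, …, x_n]`.  The summands lie in distinct degrees, so their sum is direct. -/
def gradedSum (Q : ℕ → Ideal (MvPolynomial (Fin n) K)) (k : ℕ) :
    Submodule K (MvPolynomial (Fin n) K) :=
  ⨆ j : ℕ, component (Q j) (regularity (Q 0) + k + j)

end GradedIdeal

end

noncomputable section

namespace GradedIdeal

attribute [local instance] MvPolynomial.gradedAlgebra

variable {K : Type*} [Field K] {n : ℕ}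

/-! The bridge between the two sides is a property of a pair $(Q,\ell)$, recorded as `IsRegularMod`:
$\ell$ is a linear non-zero-divisor modulo $Q$, and $\mathfrak m^r\subseteq Q+(\ell)$. Explicit
manipulation of Koszul cycles shows that it forces $\operatorname{reg}(Q)\le r$
(`IsRegularMod.regularity_le`) and, conversely, that once it holds for some $r$ it already holds for
$r=\operatorname{reg}(Q)$ (`IsRegularMod.pow_regularity_le`). Thus regularity is read off from the
Artinian quotient by $\ell$. For $d\ge r$ the ideal $Q_{\langle d\rangle}$ agrees with $Q$ in
degrees $\ge d$, has a linear resolution, and has saturation $Q$.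

From families to ideals: over an infinite field one $\ell$ is a non-zero-divisor modulo all the
$Q_j$, since only finitely many distinct ideals occur and none has an associated prime containing
$\mathfrak m$. Since $Q_0\subseteq Q_j$, the inclusion for $Q_0$ with $r=\operatorname{reg}(Q_0)$
passes to every $Q_j$. Hence each degree component of $\varphi(\mathcal Q,k)$ generates a truncation
of some $Q_j$ in a linear range, and saturating it returns $Q_j$.

From ideals to families: $I+(\ell)=\mathfrak m^{o(I)}+(\ell)$ gives $\mathfrak m^{o(I)}\subseteq
Q_0(I)+(\ell)$. Saturatedness then makes $\ell$ a non-zero-divisor modulo every $Q_j(I)$, which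
yields dimension one and $\operatorname{reg}(Q_0(I))\le o(I)$. Componentwise linearity enters only
in `component_satFamily`: an ideal generated in degree $d$ with a linear resolution has no socle in
degrees $\ge d$, so saturating it changes nothing there and $I$ is recovered degree by degree. -/

/-! ### The Koszul complex of the variables -/

/-- The sign of `e_a ∧ e_T`. -/
def koszulSign (K : Type*) [Field K] {n : ℕ} (T : Finset (Fin n)) (a : Fin n) :
    MvPolynomial (Fin n) K :=
  (-1) ^ (T.filter (fun b => b < a)).card

lemma koszulD_apply (c : Finset (Fin n) → MvPolynomial (Fin n) K) (T : Finset (Fin n)) :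
    koszulD K n c T = ∑ a ∈ Tᶜ, koszulSign K T a * X a * c (insert a T) := rfl

lemma koszulSign_mul_self (T : Finset (Fin n)) (a : Fin n) :
    koszulSign K T a * koszulSign K T a = 1 := by
  rw [koszulSign, ← pow_add, ← two_mul, pow_mul]
  simp

lemma koszulSign_isHomogeneous (T : Finset (Fin n)) (a : Fin n) :
    (koszulSign K T a).IsHomogeneous 0 := by
  have h : koszulSign K T a = C ((-1) ^ (T.filter (fun b => b < a)).card) := by
    simp [koszulSign]
  rw [h]
  exact isHomogeneous_C _ _

lemma koszulSign_insert {T : Finset (Fin n)} {a b : Fin n} (hb : b ∉ T) :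
    koszulSign K (insert b T) a = if b < a then -koszulSign K T a else koszulSign K T a := by
  unfold koszulSign
  rw [Finset.filter_insert]
  split_ifs with h
  · rw [Finset.card_insert_of_notMem (by simp [hb]), pow_succ]
    ring
  · rfl

lemma koszulSign_erase_self (T : Finset (Fin n)) (a : Fin n) :
    koszulSign K (T.erase a) a = koszulSign K T a := by
  by_cases ha : a ∈ T
  · conv_rhs => rw [← Finset.insert_erase ha]
    rw [koszulSign_insert (Finset.notMem_erase a T)]
    simp
  · rw [Finset.erase_eq_of_notMem ha]

lemma koszulSign_erase {T : Finset (Fin n)} {a b : Fin n} (ha : a ∈ T) :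
    koszulSign K (T.erase a) b = if a < b then -koszulSign K T b else koszulSign K T b := by
  conv_rhs => rw [← Finset.insert_erase ha]
  rw [koszulSign_insert (Finset.notMem_erase a T)]
  split_ifs <;> simp

/-- Exterior multiplication by `e_a`. -/
def koszulH (a : Fin n) (c : Finset (Fin n) → MvPolynomial (Fin n) K) (T : Finset (Fin n)) :
    MvPolynomial (Fin n) K :=
  if a ∈ T then koszulSign K T a * c (T.erase a) else 0

lemma koszulD_smul (f : MvPolynomial (Fin n) K) (c : Finset (Fin n) → MvPolynomial (Fin n) K) :
    koszulD K n (f • c) = f • koszulD K n c := by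
  funext T
  simp only [koszulD_apply, Pi.smul_apply, smul_eq_mul, Finset.mul_sum]
  exact Finset.sum_congr rfl fun a _ => by ring

/-- Cartan's formula: exterior multiplication by $e_a$ is a homotopy between multiplication by $x_a$
and zero. Terms removing some $b\ne a$ cancel because transposing $e_a$ and $e_b$ changes the sign;
the term removing $a$ leaves $x_a c$. -/
lemma koszulD_koszulH (a : Fin n) (c : Finset (Fin n) → MvPolynomial (Fin n) K) :
    koszulD K n (koszulH a c) + koszulH a (koszulD K n c) = (X a : MvPolynomial (Fin n) K) • c := by
  funext T
  simp only [Pi.add_apply, Pi.smul_apply, smul_eq_mul, koszulD_apply]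
  by_cases ha : a ∈ T
  · have h1 : (T.erase a)ᶜ = insert a Tᶜ := Finset.compl_erase
    rw [koszulH, if_pos ha, koszulD_apply, h1,
      Finset.sum_insert (by simpa using ha), koszulSign_erase_self, Finset.insert_erase ha,
      mul_add, Finset.mul_sum]
    have h2 : ∑ b ∈ Tᶜ, koszulSign K T b * X b * koszulH a c (insert b T) +
        ∑ b ∈ Tᶜ, koszulSign K T a *
          (koszulSign K (T.erase a) b * X b * c (insert b (T.erase a))) = 0 := by
      rw [← Finset.sum_add_distrib]
      refine Finset.sum_eq_zero fun b hb => ?_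
      have hb' : b ∉ T := by simpa using hb
      have hab : a ≠ b := fun h => hb' (h ▸ ha)
      rw [koszulH, if_pos (Finset.mem_insert_of_mem ha), koszulSign_erase ha,
        koszulSign_insert hb', Finset.erase_insert_of_ne hab.symm]
      rcases lt_or_gt_of_ne hab with h | h
      · rw [if_neg h.not_gt, if_pos h]; ring
      · rw [if_pos h, if_neg h.not_gt]; ring
    linear_combination h2 + X a * c T * koszulSign_mul_self (K := K) T a
  · rw [koszulH, if_neg ha, add_zero, Finset.sum_eq_single_of_mem a (by simpa using ha)]
    · rw [koszulH, if_pos (Finset.mem_insert_self a T), Finset.erase_insert ha,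
        koszulSign_insert ha, if_neg (lt_irrefl a)]
      linear_combination X a * c T * koszulSign_mul_self (K := K) T a
    · intro b _ hba
      rw [koszulH, if_neg (by simp [ha, hba.symm]), mul_zero]

lemma koszulD_koszulD (c : Finset (Fin n) → MvPolynomial (Fin n) K) :
    koszulD K n (koszulD K n c) = 0 := by
  funext T
  simp only [koszulD_apply, Finset.mul_sum, Pi.zero_apply]
  rw [Finset.sum_sigma']
  -- Removing $a$ then $b$ and removing $b$ then $a$ contribute with opposite signs.
  refine Finset.sum_involution (fun p _ => ⟨p.2, p.1⟩) ?_ ?_ ?_ ?_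
  · rintro ⟨a, b⟩ h
    simp only [Finset.mem_sigma, Finset.mem_compl, Finset.mem_insert, not_or] at h
    obtain ⟨ha, hba, hb⟩ := h
    dsimp only
    rw [koszulSign_insert ha, koszulSign_insert hb, Finset.insert_comm b a]
    rcases lt_or_gt_of_ne hba with h | h
    · rw [if_neg h.not_gt, if_pos h]; ring
    · rw [if_pos h, if_neg h.not_gt]; ring
  · rintro ⟨a, b⟩ h _ h'
    simp only [Finset.mem_sigma, Finset.mem_compl, Finset.mem_insert, not_or] at h
    simp only [Sigma.mk.injEq, heq_eq_eq] at h'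
    exact h.2.1 h'.1
  · rintro ⟨a, b⟩ h
    simp only [Finset.mem_sigma, Finset.mem_compl, Finset.mem_insert, not_or] at h ⊢
    exact ⟨h.2.2, fun e => h.2.1 e.symm, h.1⟩
  · rintro ⟨a, b⟩ _
    rfl

/-! ### Chains with homogeneous coefficients in an ideal -/

/-- `c` is an element of homological degree `i` of the Koszul complex, with coefficients in
`I` that are forms of degree `s`. -/
def IsChain (I : Ideal (MvPolynomial (Fin n) K)) (i s : ℕ)
    (c : Finset (Fin n) → MvPolynomial (Fin n) K) : Prop :=
  ∀ S, c S ∈ I ∧ (c S).IsHomogeneous s ∧ (S.card ≠ i → c S = 0)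

lemma isHomogeneous_iff_degree (f : MvPolynomial (Fin n) K) (s : ℕ) :
    f.IsHomogeneous s ↔ ∀ m ∈ f.support, m.degree = s := by
  constructor
  · intro h m hm
    by_contra hne
    exact (mem_support_iff.mp hm) (h.coeff_eq_zero hne)
  · intro h m hm
    have := h m (mem_support_iff.mpr hm)
    rw [Finsupp.degree_eq_weight_one] at this
    exact this

lemma mem_koszulChains {I : Ideal (MvPolynomial (Fin n) K)} {i s : ℕ}
    {c : Finset (Fin n) → MvPolynomial (Fin n) K} :
    c ∈ koszulChains I i (i + s) ↔ IsChain I i s c := by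
  simp only [koszulChains, Submodule.mem_pi, Set.mem_univ, true_imp_iff, IsChain]
  refine forall_congr' fun S => ?_
  by_cases hS : S.card = i
  · rw [if_pos hS, Submodule.mem_inf, Submodule.restrictScalars_mem, mem_restrictSupport_iff,
      isHomogeneous_iff_degree]
    have : (↑(c S).support ⊆ {m : Fin n →₀ ℕ | m.degree + i = i + s}) ↔
        ∀ m ∈ (c S).support, m.degree = s :=
      forall_congr' fun m => imp_congr_right fun _ => by
        simp only [Set.mem_ofPred_eq]; omega
    rw [this]
    simp [hS]
  · rw [if_neg hS, Submodule.mem_bot]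
    refine ⟨fun h => ?_, fun h => h.2.2 hS⟩
    rw [h]
    exact ⟨I.zero_mem, isHomogeneous_zero _ _ _, fun _ => rfl⟩

namespace IsChain

variable {I J : Ideal (MvPolynomial (Fin n) K)} {i s : ℕ}
  {c c' : Finset (Fin n) → MvPolynomial (Fin n) K}

lemma zero : IsChain I i s 0 :=
  fun _ => ⟨I.zero_mem, isHomogeneous_zero _ _ _, fun _ => rfl⟩

lemma add (h : IsChain I i s c) (h' : IsChain I i s c') : IsChain I i s (c + c') := fun S =>
  ⟨I.add_mem (h S).1 (h' S).1, (h S).2.1.add (h' S).2.1, fun hS => by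
    rw [Pi.add_apply, (h S).2.2 hS, (h' S).2.2 hS, add_zero]⟩

lemma sub (h : IsChain I i s c) (h' : IsChain I i s c') : IsChain I i s (c - c') := fun S =>
  ⟨I.sub_mem (h S).1 (h' S).1, (h S).2.1.sub (h' S).2.1, fun hS => by
    rw [Pi.sub_apply, (h S).2.2 hS, (h' S).2.2 hS, sub_zero]⟩

lemma mono (h : IsChain I i s c) (hIJ : I ≤ J) : IsChain J i s c :=
  fun S => ⟨hIJ (h S).1, (h S).2⟩

lemma smul (h : IsChain I i s c) {f : MvPolynomial (Fin n) K} {t : ℕ} (hf : f.IsHomogeneous t) :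
    IsChain I i (t + s) (f • c) := fun S =>
  ⟨I.mul_mem_left f (h S).1, hf.mul (h S).2.1, fun hS => by
    rw [Pi.smul_apply, (h S).2.2 hS, smul_zero]⟩

lemma koszulD (h : IsChain I (i + 1) s c) : IsChain I i (s + 1) (koszulD K n c) := by
  intro T
  rw [koszulD_apply]
  refine ⟨I.sum_mem fun a _ => I.mul_mem_left _ (h _).1, IsHomogeneous.sum _ _ _ fun a _ => ?_,
    fun hT => Finset.sum_eq_zero fun a ha => ?_⟩
  · have := ((koszulSign_isHomogeneous (K := K) T a).mul (isHomogeneous_X K a)).mul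
      (h (insert a T)).2.1
    rwa [zero_add, add_comm] at this
  · rw [(h _).2.2, mul_zero]
    rw [Finset.card_insert_of_notMem (by simpa using ha)]
    omega

lemma koszulD_eq_zero (h : IsChain I 0 s c) : GradedIdeal.koszulD K n c = 0 := by
  funext T
  rw [koszulD_apply]
  refine Finset.sum_eq_zero fun a ha => ?_
  rw [(h _).2.2, mul_zero]
  rw [Finset.card_insert_of_notMem (by simpa using ha)]
  omega

lemma koszulH (h : IsChain I i s c) (a : Fin n) : IsChain I (i + 1) s (koszulH a c) := by
  intro T
  unfold GradedIdeal.koszulH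
  split_ifs with ha
  · refine ⟨I.mul_mem_left _ (h _).1, ?_, fun hT => ?_⟩
    · have := (koszulSign_isHomogeneous (K := K) T a).mul (h (T.erase a)).2.1
      rwa [zero_add] at this
    · rw [(h _).2.2, mul_zero]
      have := Finset.card_erase_add_one ha
      omega
  · exact ⟨I.zero_mem, isHomogeneous_zero _ _ _, fun _ => rfl⟩

end IsChain

/-! ### Acyclicity of the Koszul complex over the polynomial ring -/

lemma X_mul_divMonomial_of_ne {a b : Fin n} (h : b ≠ a) (f : MvPolynomial (Fin n) K) :
    (X b * f).divMonomial (Finsupp.single a 1) = X b * f.divMonomial (Finsupp.single a 1) := by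
  ext m
  rw [coeff_divMonomial, coeff_X_mul', coeff_X_mul']
  have h1 : b ∈ (Finsupp.single a 1 + m).support ↔ b ∈ m.support := by
    simp [h.symm]
  by_cases hb : b ∈ m.support
  · rw [if_pos (h1.mpr hb), if_pos hb, coeff_divMonomial]
    congr 1
    refine (add_tsub_assoc_of_le ?_ _)
    rw [Finsupp.single_le_iff]
    exact Nat.one_le_iff_ne_zero.mpr (Finsupp.mem_support_iff.mp hb)
  · rw [if_neg (fun h => hb (h1.mp h)), if_neg hb]

lemma divMonomial_koszulSign_mul (T : Finset (Fin n)) (a b : Fin n) (f : MvPolynomial (Fin n) K) :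
    (koszulSign K T b * f).divMonomial (Finsupp.single a 1) =
      koszulSign K T b * f.divMonomial (Finsupp.single a 1) := by
  have h : koszulSign K T b = C ((-1) ^ (T.filter (fun c => c < b)).card) := by
    simp [koszulSign]
  ext m
  rw [h, coeff_divMonomial, coeff_C_mul, coeff_C_mul, coeff_divMonomial]

lemma sum_divMonomial {ι : Type*} (s : Finset ι) (f : ι → MvPolynomial (Fin n) K)
    (m : Fin n →₀ ℕ) :
    (∑ i ∈ s, f i).divMonomial m = ∑ i ∈ s, (f i).divMonomial m := by
  ext m'
  simp only [coeff_divMonomial, coeff_sum]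

/-- Modulo a boundary, a cycle `z` does not involve the variable `x_a`. -/
lemma koszulD_koszulH_divMonomial {z : Finset (Fin n) → MvPolynomial (Fin n) K}
    (hz : koszulD K n z = 0) (a : Fin n) (S : Finset (Fin n)) :
    z S - koszulD K n (koszulH a fun T => (z T).divMonomial (Finsupp.single a 1)) S =
      if a ∈ S then 0 else (z S).modMonomial (Finsupp.single a 1) := by
  set u : Finset (Fin n) → MvPolynomial (Fin n) K :=
    fun T => (z T).divMonomial (Finsupp.single a 1) with hu
  have hzu : ∀ T, z T = X a * u T + (z T).modMonomial (Finsupp.single a 1) := fun T =>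
    (divMonomial_add_modMonomial_single (z T) a).symm
  have h1 := congrFun (koszulD_koszulH a u) S
  simp only [Pi.add_apply, Pi.smul_apply, smul_eq_mul] at h1
  split_ifs with ha
  · rw [koszulH, if_pos ha] at h1
    have hT := congrFun hz (S.erase a)
    rw [koszulD_apply, Finset.compl_erase, Finset.sum_insert (by simpa using ha),
      Finset.insert_erase ha, koszulSign_erase_self, Pi.zero_apply] at hT
    -- Dividing the cycle relation at $S\setminus\{a\}$ by $x_a$ is what kills the coefficients with
    -- $a\in S$: the term for $a$ yields $z_S$ itself, and division commutes with the other
    -- variables.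
    have hT2 := congrArg (fun f => f.divMonomial (Finsupp.single a 1)) hT
    simp only [add_divMonomial, zero_divMonomial, sum_divMonomial, mul_assoc,
      divMonomial_koszulSign_mul, X_mul_divMonomial] at hT2
    have hD : koszulD K n u (S.erase a) = koszulSign K S a * (X a * u S) +
        ∑ b ∈ Sᶜ, koszulSign K (S.erase a) b *
          (X b * z (insert b (S.erase a))).divMonomial (Finsupp.single a 1) := by
      rw [koszulD_apply, Finset.compl_erase, Finset.sum_insert (by simpa using ha),
        Finset.insert_erase ha, koszulSign_erase_self, mul_assoc]
      congr 1
      refine Finset.sum_congr rfl fun b hb => ?_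
      have hba : b ≠ a := fun h => (by simpa using hb : b ∉ S) (h ▸ ha)
      rw [X_mul_divMonomial_of_ne hba, mul_assoc]
    linear_combination -h1 + koszulSign K S a * hD + koszulSign K S a * hT2 +
      (X a * u S - z S) * koszulSign_mul_self (K := K) S a
  · rw [koszulH, if_neg ha, add_zero] at h1
    linear_combination hzu S - h1

/-- The variables are eliminated one at a time by subtracting boundaries. Each correction only
deletes coefficients or monomials of the current cycle, so earlier eliminations survive. The
correction has coefficient degree $s-1$, hence the separate clause for $s=0$. -/
lemma exists_cycle_sub_koszulD {i s : ℕ} {z : Finset (Fin n) → MvPolynomial (Fin n) K}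
    (hc : IsChain ⊤ i s z) (hz : koszulD K n z = 0) (A : Finset (Fin n)) :
    ∃ w, IsChain ⊤ i s (z - koszulD K n w) ∧
      (∀ s', s = s' + 1 → IsChain ⊤ (i + 1) s' w) ∧ (s = 0 → w = 0) ∧
      ∀ a ∈ A, ∀ S, (a ∈ S → (z - koszulD K n w) S = 0) ∧
        ∀ m ∈ ((z - koszulD K n w) S).support, m a = 0 := by
  classical
  induction A using Finset.induction_on with
  | empty =>
    exact ⟨0, by simpa using hc, fun _ _ => IsChain.zero, fun _ => rfl, by simp⟩
  | insert a A _ ih =>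
    obtain ⟨w, h1, h2, h3, h4⟩ := ih
    set y := z - koszulD K n w with hy
    have hy0 : koszulD K n y = 0 := by rw [hy, map_sub, hz, koszulD_koszulD, sub_zero]
    set u : Finset (Fin n) → MvPolynomial (Fin n) K :=
      fun T => (y T).divMonomial (Finsupp.single a 1) with hu
    have key := koszulD_koszulH_divMonomial hy0 a
    have hsub : z - koszulD K n (w + koszulH a u) =
        fun S => if a ∈ S then 0 else (y S).modMonomial (Finsupp.single a 1) := by
      funext S
      rw [← key S, map_add, ← sub_sub, ← hy]
      rfl
    have hsupp : ∀ S, ∀ m ∈ (if a ∈ S then 0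
        else (y S).modMonomial (Finsupp.single a 1)).support, m a = 0 ∧ m ∈ (y S).support := by
      intro S m hm
      split_ifs at hm
      · simp at hm
      · rw [mem_support_iff] at hm
        have : ¬ Finsupp.single a 1 ≤ m := fun h => hm (coeff_modMonomial_of_le _ h)
        refine ⟨?_, ?_⟩
        · rw [Finsupp.single_le_iff] at this
          omega
        · rwa [mem_support_iff, ← coeff_modMonomial_of_not_le _ this]
    refine ⟨w + koszulH a u, ?_, ?_, ?_, ?_⟩
    · rw [hsub]
      intro S
      refine ⟨Submodule.mem_top, ?_, fun hS => ?_⟩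
      · rw [isHomogeneous_iff_degree]
        intro m hm
        exact (isHomogeneous_iff_degree _ _).mp (h1 S).2.1 m (hsupp S m hm).2
      · dsimp only
        rw [(h1 S).2.2 hS]
        ext m
        split_ifs
        · rfl
        · by_cases h : Finsupp.single a 1 ≤ m
          · rw [coeff_modMonomial_of_le _ h, coeff_zero]
          · rw [coeff_modMonomial_of_not_le _ h]
    · intro s' hs'
      refine (h2 s' hs').add (IsChain.koszulH (fun S => ⟨Submodule.mem_top, ?_, fun hS => ?_⟩) a)
      · rw [isHomogeneous_iff_degree]
        intro m hm
        rw [mem_support_iff, hu, coeff_divMonomial] at hm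
        have := (isHomogeneous_iff_degree _ _).mp (h1 S).2.1 _ (mem_support_iff.mpr hm)
        rw [map_add, Finsupp.degree_single] at this
        omega
      · simp only [hu]
        rw [(h1 S).2.2 hS, zero_divMonomial]
    · intro hs
      rw [h3 hs, zero_add]
      have hu0 : u = 0 := by
        funext S
        ext m
        simp only [hu]
        rw [coeff_divMonomial]
        refine (h1 S).2.1.coeff_eq_zero ?_
        rw [map_add, Finsupp.degree_single]
        omega
      funext T
      simp [koszulH, hu0]
    · rw [hsub]
      intro b hb S
      rcases Finset.mem_insert.mp hb with rfl | hb
      · exact ⟨fun h => if_pos h, fun m hm => (hsupp S m hm).1⟩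
      · refine ⟨fun h => ?_, fun m hm => (h4 b hb S).2 m (hsupp S m hm).2⟩
        dsimp only
        split_ifs
        · rfl
        · rw [(h4 b hb S).1 h]
          ext m
          by_cases h : Finsupp.single a 1 ≤ m
          · rw [coeff_modMonomial_of_le _ h, coeff_zero]
          · rw [coeff_modMonomial_of_not_le _ h]

/-- Once every variable is eliminated, only a constant multiple of $e_\emptyset$ can remain, and
this is excluded unless $i=s=0$. -/
lemma exists_koszulD_eq {i s : ℕ} {z : Finset (Fin n) → MvPolynomial (Fin n) K}
    (hc : IsChain ⊤ i s z) (hz : koszulD K n z = 0) (his : i ≠ 0 ∨ s ≠ 0) :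
    ∃ w, (∀ s', s = s' + 1 → IsChain ⊤ (i + 1) s' w) ∧ (s = 0 → w = 0) ∧ koszulD K n w = z := by
  obtain ⟨w, h1, h2, h3, h4⟩ := exists_cycle_sub_koszulD hc hz Finset.univ
  refine ⟨w, h2, h3, ?_⟩
  rw [eq_comm, ← sub_eq_zero]
  funext S
  rcases S.eq_empty_or_nonempty with rfl | ⟨a, ha⟩
  · rcases his with hi | hs
    · exact (h1 ∅).2.2 (by simpa using hi.symm)
    · rw [Pi.zero_apply, ← support_eq_empty, Finset.eq_empty_iff_forall_notMem]
      intro m hm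
      have hm0 : m = 0 := Finsupp.ext fun a => (h4 a (Finset.mem_univ a) ∅).2 m hm
      have := (isHomogeneous_iff_degree _ _).mp (h1 ∅).2.1 m hm
      rw [hm0, map_zero] at this
      exact hs this.symm
  · exact (h4 a (Finset.mem_univ a) S).1 ha

/-! ### Homogeneous ideals -/

lemma mem_component {I : Ideal (MvPolynomial (Fin n) K)} {j : ℕ} {f : MvPolynomial (Fin n) K} :
    f ∈ component I j ↔ f ∈ I ∧ f.IsHomogeneous j := by
  rw [component, Submodule.mem_inf, Submodule.restrictScalars_mem, mem_homogeneousSubmodule]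

lemma component_mono {I J : Ideal (MvPolynomial (Fin n) K)} (h : I ≤ J) (j : ℕ) :
    component I j ≤ component J j := fun _ hf =>
  mem_component.mpr ⟨h (mem_component.mp hf).1, (mem_component.mp hf).2⟩

lemma coe_decompose (f : MvPolynomial (Fin n) K) (i : ℕ) :
    (DirectSum.decompose (homogeneousSubmodule (Fin n) K) f i : MvPolynomial (Fin n) K) =
      homogeneousComponent i f :=
  decomposition.decompose'_apply f i

lemma homog_iff {I : Ideal (MvPolynomial (Fin n) K)} :
    Homog I ↔ ∀ f ∈ I, ∀ d, homogeneousComponent d f ∈ I :=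
  ⟨fun h _ hf d => homogeneousComponent_mem_of_mem h hf d,
    fun h i f hf => by rw [coe_decompose]; exact h f hf i⟩

lemma Homog.mem_iff {I : Ideal (MvPolynomial (Fin n) K)} (h : Homog I)
    {f : MvPolynomial (Fin n) K} : f ∈ I ↔ ∀ d, homogeneousComponent d f ∈ I :=
  mem_iff_homogeneousComponent_mem h f

lemma homog_span {s : Set (MvPolynomial (Fin n) K)} (h : ∀ f ∈ s, ∃ d, f.IsHomogeneous d) :
    Homog (Ideal.span s) :=
  Ideal.homogeneous_span _ s h

lemma Homog.sup {I J : Ideal (MvPolynomial (Fin n) K)} (hI : Homog I) (hJ : Homog J) :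
    Homog (I ⊔ J) :=
  Ideal.IsHomogeneous.sup hI hJ

lemma homog_componentIdeal (I : Ideal (MvPolynomial (Fin n) K)) (d : ℕ) :
    Homog (componentIdeal I d) :=
  homog_span fun _ hf => ⟨d, (mem_component.mp hf).2⟩

lemma homogeneousComponent_mul_add {f : MvPolynomial (Fin n) K} {i : ℕ} (hf : f.IsHomogeneous i)
    (g : MvPolynomial (Fin n) K) (j : ℕ) :
    homogeneousComponent (i + j) (f * g) = f * homogeneousComponent j g := by
  rw [← coe_decompose, ← coe_decompose]
  exact DirectSum.coe_decompose_mul_add_of_left_mem _ hf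

lemma homogeneousComponent_mul_of_lt {f : MvPolynomial (Fin n) K} {i : ℕ} (hf : f.IsHomogeneous i)
    (g : MvPolynomial (Fin n) K) {j : ℕ} (hj : j < i) :
    homogeneousComponent j (f * g) = 0 := by
  rw [← coe_decompose]
  exact DirectSum.coe_decompose_mul_of_left_mem_of_not_le _ hf hj.not_ge

lemma mem_pow_idealOfVars_of_isHomogeneous {f : MvPolynomial (Fin n) K} {d e : ℕ}
    (hf : f.IsHomogeneous e) (h : d ≤ e) : f ∈ idealOfVars (Fin n) K ^ d := by
  rw [mem_pow_idealOfVars_iff]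
  intro m hm
  rw [(isHomogeneous_iff_degree f e).mp hf m hm]
  exact h

lemma pow_idealOfVars_le_iff {I : Ideal (MvPolynomial (Fin n) K)} {d : ℕ} :
    idealOfVars (Fin n) K ^ d ≤ I ↔ ∀ f : MvPolynomial (Fin n) K, f.IsHomogeneous d → f ∈ I := by
  refine ⟨fun h f hf => h (mem_pow_idealOfVars_of_isHomogeneous hf le_rfl), fun h => ?_⟩
  rw [pow_idealOfVars_eq_span, Ideal.span_le]
  rintro _ ⟨m, hm, rfl⟩
  exact h _ (isHomogeneous_monomial _ hm)

lemma homog_pow_idealOfVars (d : ℕ) : Homog (idealOfVars (Fin n) K ^ d) := by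
  rw [pow_idealOfVars_eq_span]
  refine homog_span ?_
  rintro _ ⟨m, hm, rfl⟩
  exact ⟨d, isHomogeneous_monomial _ hm⟩

lemma isHomogeneous_one_eq_sum {l : MvPolynomial (Fin n) K} (hl : l.IsHomogeneous 1) :
    ∃ c : Fin n → K, l = ∑ a, C (c a) * X a := by
  have h : l ∈ homogeneousSubmodule (Fin n) K 1 := hl
  rw [homogeneousSubmodule_one_eq_span_X, Submodule.mem_span_range_iff_exists_fun] at h
  obtain ⟨c, hc⟩ := h
  exact ⟨c, by rw [← hc]; simp only [smul_eq_C_mul]⟩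

lemma mul_mem_of_forall_X_mul_mem {I : Ideal (MvPolynomial (Fin n) K)}
    {f l : MvPolynomial (Fin n) K} (hl : l.IsHomogeneous 1) (h : ∀ a, X a * f ∈ I) :
    l * f ∈ I := by
  obtain ⟨c, rfl⟩ := isHomogeneous_one_eq_sum hl
  rw [Finset.sum_mul]
  exact I.sum_mem fun a _ => by rw [mul_assoc]; exact I.mul_mem_left _ (h a)

/-- Taking degree-$s$ parts makes the decomposition homogeneous. A multiple of $\ell$ has no part of
degree $0$, which is why $g$ vanishes when $s=0$. -/
lemma exists_add_mul_of_mem_sup {Q : Ideal (MvPolynomial (Fin n) K)} (hQ : Homog Q)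
    {l : MvPolynomial (Fin n) K} (hl : l.IsHomogeneous 1) {f : MvPolynomial (Fin n) K} {s : ℕ}
    (hf : f.IsHomogeneous s) (h : f ∈ Q ⊔ Ideal.span {l}) :
    ∃ q ∈ Q, ∃ g : MvPolynomial (Fin n) K, f = q + l * g ∧ q.IsHomogeneous s ∧
      (∀ s', s = s' + 1 → g.IsHomogeneous s') ∧ (s = 0 → g = 0) := by
  obtain ⟨q, hq, y, hy, rfl⟩ := Submodule.mem_sup.mp h
  obtain ⟨g, rfl⟩ := Ideal.mem_span_singleton'.mp hy
  have h1 := homogeneousComponent_eq_self hf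
  rw [map_add, mul_comm g] at h1
  refine ⟨homogeneousComponent s q, homog_iff.mp hQ q hq s, ?_⟩
  rcases s with _ | s
  · refine ⟨0, ?_, homogeneousComponent_isHomogeneous _ _, fun s' hs' => ?_, fun _ => rfl⟩
    · rw [homogeneousComponent_mul_of_lt hl g zero_lt_one] at h1
      rw [mul_comm g, ← h1, mul_zero]
    · omega
  · refine ⟨homogeneousComponent s g, ?_, homogeneousComponent_isHomogeneous _ _,
      fun s' hs' => ?_, fun h => by omega⟩
    · rw [add_comm s 1, homogeneousComponent_mul_add hl] at h1
      rw [mul_comm g, add_comm s 1, h1]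
    · obtain rfl : s = s' := by omega
      exact homogeneousComponent_isHomogeneous _ _

/-! ### Saturation -/

lemma mem_saturation {I : Ideal (MvPolynomial (Fin n) K)} {f : MvPolynomial (Fin n) K} :
    f ∈ saturation I ↔ ∃ k, ∀ u ∈ idealOfVars (Fin n) K ^ k, u * f ∈ I := by
  rw [saturation, Submodule.mem_iSup_of_directed]
  · refine exists_congr fun k => ?_
    rw [Submodule.mem_colon]
    exact forall₂_congr fun u _ => by rw [smul_eq_mul, mul_comm]
  · refine Monotone.directed_le fun k k' hk f hf => ?_
    rw [Submodule.mem_colon] at hf ⊢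
    exact fun u hu => hf u (Ideal.pow_le_pow_right hk hu)

lemma le_saturation (I : Ideal (MvPolynomial (Fin n) K)) : I ≤ saturation I :=
  fun _ hf => mem_saturation.mpr ⟨0, fun _ _ => I.mul_mem_left _ hf⟩

lemma saturation_mono {I J : Ideal (MvPolynomial (Fin n) K)} (h : I ≤ J) :
    saturation I ≤ saturation J := fun _ hf => by
  obtain ⟨k, hk⟩ := mem_saturation.mp hf
  exact mem_saturation.mpr ⟨k, fun u hu => h (hk u hu)⟩

/-- By noetherianity $\mathfrak m^k f$ has finitely many generators, so a single power $\mathfrak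
m^{k'}$ carries all of it into $I$; then $\mathfrak m^{k'+k}f\subseteq I$. -/
lemma mem_saturation_of_pow_mul {I : Ideal (MvPolynomial (Fin n) K)} {f : MvPolynomial (Fin n) K}
    {k : ℕ} (h : ∀ u ∈ idealOfVars (Fin n) K ^ k, u * f ∈ saturation I) : f ∈ saturation I := by
  have hle : idealOfVars (Fin n) K ^ k * Ideal.span {f} ≤ saturation I := by
    rw [Ideal.mul_le]
    intro u hu g hg
    obtain ⟨a, rfl⟩ := Ideal.mem_span_singleton'.mp hg
    rw [mul_left_comm]
    exact Ideal.mul_mem_left _ _ (h u hu)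
  obtain ⟨s, hs⟩ : (idealOfVars (Fin n) K ^ k * Ideal.span {f}).FG :=
    IsNoetherian.noetherian _
  have hex : ∀ t : Finset (MvPolynomial (Fin n) K), (∀ g ∈ t, g ∈ saturation I) →
      ∃ k', ∀ g ∈ t, ∀ u ∈ idealOfVars (Fin n) K ^ k', u * g ∈ I := by
    classical
    intro t
    induction t using Finset.induction_on with
    | empty => exact fun _ => ⟨0, by simp⟩
    | insert g t _ ih =>
      intro ht
      obtain ⟨k1, h1⟩ := ih fun g hg => ht g (Finset.mem_insert_of_mem hg)
      obtain ⟨k2, h2⟩ := mem_saturation.mp (ht g (Finset.mem_insert_self g t))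
      refine ⟨max k1 k2, fun g' hg' u hu => ?_⟩
      rcases Finset.mem_insert.mp hg' with rfl | hg'
      · exact h2 u (Ideal.pow_le_pow_right (le_max_right _ _) hu)
      · exact h1 g' hg' u (Ideal.pow_le_pow_right (le_max_left _ _) hu)
  obtain ⟨k', hk'⟩ := hex s fun g hg => hle (hs ▸ Ideal.subset_span hg)
  have hcol : idealOfVars (Fin n) K ^ k * Ideal.span {f} ≤
      I.colon ((idealOfVars (Fin n) K ^ k' : Ideal _) : Set (MvPolynomial (Fin n) K)) := by
    rw [← hs, Submodule.span_le]
    intro g hg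
    rw [SetLike.mem_coe, Submodule.mem_colon]
    intro u hu
    rw [smul_eq_mul, mul_comm]
    exact hk' g hg u hu
  refine mem_saturation.mpr ⟨k' + k, ?_⟩
  have : idealOfVars (Fin n) K ^ (k' + k) * Ideal.span {f} ≤ I := by
    rw [pow_add, mul_assoc, Ideal.mul_le]
    intro u hu g hg
    have := (Submodule.mem_colon.mp (hcol hg)) u hu
    rwa [smul_eq_mul, mul_comm] at this
  exact fun u hu => this (Ideal.mul_mem_mul hu (Ideal.mem_span_singleton_self f))

lemma saturation_saturation (I : Ideal (MvPolynomial (Fin n) K)) :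
    saturation (saturation I) = saturation I := by
  refine le_antisymm (fun f hf => ?_) (le_saturation _)
  obtain ⟨k, hk⟩ := mem_saturation.mp hf
  exact mem_saturation_of_pow_mul hk

lemma Homog.saturation {I : Ideal (MvPolynomial (Fin n) K)} (h : Homog I) :
    Homog (saturation I) := by
  rw [homog_iff]
  intro f hf d
  obtain ⟨k, hk⟩ := mem_saturation.mp hf
  refine mem_saturation.mpr ⟨k, ?_⟩
  have : idealOfVars (Fin n) K ^ k ≤ I.colon {homogeneousComponent d f} := by
    rw [pow_idealOfVars_le_iff]
    intro u hu
    rw [Submodule.mem_colon_singleton, smul_eq_mul, ← homogeneousComponent_mul_add hu]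
    exact homog_iff.mp h _ (hk u (mem_pow_idealOfVars_of_isHomogeneous hu le_rfl)) _
  intro u hu
  have := this hu
  rwa [Submodule.mem_colon_singleton, smul_eq_mul] at this

/-- A socle criterion for the comparison of an ideal and its saturation. -/
lemma mem_of_mem_saturation {I : Ideal (MvPolynomial (Fin n) K)} {d : ℕ}
    (hI : ∀ (f : MvPolynomial (Fin n) K) (e : ℕ), d ≤ e → f.IsHomogeneous e →
      (∀ a, X a * f ∈ I) → f ∈ I)
    {f : MvPolynomial (Fin n) K} {e : ℕ} (he : d ≤ e) (hf : f.IsHomogeneous e)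
    (h : f ∈ saturation I) : f ∈ I := by
  obtain ⟨k, hk⟩ := mem_saturation.mp h
  have key : ∀ k e (f : MvPolynomial (Fin n) K), d ≤ e → f.IsHomogeneous e →
      (∀ u : MvPolynomial (Fin n) K, u.IsHomogeneous k → u * f ∈ I) → f ∈ I := by
    intro k
    induction k with
    | zero =>
      intro e f _ _ h
      simpa using h 1 (isHomogeneous_one _ _)
    | succ k ih =>
      intro e f he hf h
      refine hI f e he hf fun a => ih (1 + e) _ (by omega) ((isHomogeneous_X K a).mul hf) ?_
      intro u hu
      rw [← mul_assoc]
      exact h _ (hu.mul (isHomogeneous_X K a))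
  exact key k e f he hf fun u hu => hk u (mem_pow_idealOfVars_of_isHomogeneous hu le_rfl)

/-! ### Regularity and Koszul cycles -/

lemma gradedBetti_eq_zero_iff {I : Ideal (MvPolynomial (Fin n) K)} {i s : ℕ} :
    gradedBetti I i (i + s) = 0 ↔ ∀ z, IsChain I i s z → koszulD K n z = 0 →
      ∃ w ∈ koszulChains I (i + 1) (i + s), koszulD K n w = z := by
  -- `finrank` is also $0$ on infinite-dimensional spaces, so finiteness is needed to conclude that
  -- the homology vanishes.
  have hfin : Module.Finite K (koszulCycles I i (i + s)) := by
    have h1 : (Submodule.pi Set.univ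
        (fun _ : Finset (Fin n) => homogeneousSubmodule (Fin n) K s)).FG :=
      Submodule.fg_pi fun _ => homogeneousSubmodule_fg (Fin n) K s
    have := Module.Finite.iff_fg.mpr h1
    refine Submodule.finiteDimensional_of_le
      (S₂ := Submodule.pi Set.univ
        (fun _ : Finset (Fin n) => homogeneousSubmodule (Fin n) K s)) fun c hc => ?_
    rw [Submodule.mem_pi]
    exact fun S _ => ((mem_koszulChains.mp (Submodule.mem_inf.mp hc).1) S).2.1
  rw [gradedBetti, Module.finrank_zero_iff, Submodule.Quotient.subsingleton_iff,
    Submodule.submoduleOf_eq_top]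
  constructor
  · intro h z hz hz0
    have := h (Submodule.mem_inf.mpr ⟨mem_koszulChains.mpr hz, LinearMap.mem_ker.mpr hz0⟩)
    exact Submodule.mem_map.mp this
  · intro h z hz
    obtain ⟨h1, h2⟩ := Submodule.mem_inf.mp hz
    obtain ⟨w, hw, hwz⟩ := h z (mem_koszulChains.mp h1) (LinearMap.mem_ker.mp h2)
    exact Submodule.mem_map.mpr ⟨w, hw, hwz⟩

lemma gradedBetti_succ_eq_zero_iff {I : Ideal (MvPolynomial (Fin n) K)} {i s : ℕ} :
    gradedBetti I i (i + (s + 1)) = 0 ↔ ∀ z, IsChain I i (s + 1) z → koszulD K n z = 0 →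
      ∃ w, IsChain I (i + 1) s w ∧ koszulD K n w = z := by
  rw [gradedBetti_eq_zero_iff]
  refine forall₃_congr fun z _ _ => exists_congr fun w => and_congr_left fun _ => ?_
  rw [show i + (s + 1) = i + 1 + s by ring, mem_koszulChains]

lemma regularity_le {I : Ideal (MvPolynomial (Fin n) K)} {r : ℕ}
    (h : ∀ i s, r < s → gradedBetti I i (i + s) = 0) : regularity I ≤ r := by
  refine csSup_le' ?_
  rintro s ⟨i, j, hij, rfl⟩
  by_contra hlt
  exact hij (by rw [add_comm]; exact h i s (not_le.mp hlt))

/-- Boundedness is a separate hypothesis because the supremum of an unbounded set of natural numbers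
is $0$ by convention. -/
lemma gradedBetti_eq_zero_of_regularity_lt {I : Ideal (MvPolynomial (Fin n) K)} {i s : ℕ}
    (hb : BddAbove {r | ∃ i j : ℕ, gradedBetti I i j ≠ 0 ∧ r + i = j}) (h : regularity I < s) :
    gradedBetti I i (i + s) = 0 := by
  by_contra hne
  exact h.not_ge (le_csSup hb ⟨i, i + s, hne, add_comm _ _⟩)

lemma bddAbove_of_gradedBetti {I : Ideal (MvPolynomial (Fin n) K)} {r : ℕ}
    (h : ∀ i s, r < s → gradedBetti I i (i + s) = 0) :
    BddAbove {r | ∃ i j : ℕ, gradedBetti I i j ≠ 0 ∧ r + i = j} := by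
  refine ⟨r, ?_⟩
  rintro s ⟨i, j, hij, rfl⟩
  by_contra hlt
  exact hij (by rw [add_comm]; exact h i s (not_le.mp hlt))

/-- An ideal with vanishing Betti numbers beyond the strand `d` has no socle in degrees `≥ d`. -/
lemma mem_of_forall_X_mul_mem {I : Ideal (MvPolynomial (Fin n) K)} {d : ℕ} (hn : n ≠ 0)
    (hI : ∀ i s, d < s → gradedBetti I i (i + s) = 0)
    {f : MvPolynomial (Fin n) K} {e : ℕ} (he : d ≤ e) (hf : f.IsHomogeneous e)
    (h : ∀ a, X a * f ∈ I) : f ∈ I := by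
  obtain ⟨m, rfl⟩ := Nat.exists_eq_succ_of_ne_zero hn
  -- The chain $f e_{\{1,\dots,n\}}$ need not lie in $I$, but its boundary does. A primitive of that
  -- boundary with coefficients in $I$ must have the same top coefficient $f$, since the variable
  -- $x_0$ cancels.
  set c : Finset (Fin (m + 1)) → MvPolynomial (Fin (m + 1)) K :=
    fun S => if S = Finset.univ then f else 0 with hc
  have hchain : IsChain ⊤ (m + 1) e c := by
    refine fun S => ⟨Submodule.mem_top, ?_, fun hS => if_neg ?_⟩
    · simp only [hc]
      split_ifs
      · exact hf
      · exact isHomogeneous_zero _ _ _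
    · rintro rfl
      simp at hS
  have hD : IsChain I m (e + 1) (koszulD K (m + 1) c) := by
    refine fun T => ⟨?_, (hchain.koszulD T).2⟩
    rw [koszulD_apply]
    refine I.sum_mem fun a _ => ?_
    rw [mul_assoc]
    refine I.mul_mem_left _ ?_
    simp only [hc]
    split_ifs
    · exact h a
    · rw [mul_zero]; exact I.zero_mem
  obtain ⟨w, hw, hwD⟩ := gradedBetti_succ_eq_zero_iff.mp (hI m (e + 1) (by omega)) _ hD
    (koszulD_koszulD c)
  have ha := congrFun hwD (Finset.univ.erase (0 : Fin (m + 1)))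
  have h0 : (Finset.univ.erase (0 : Fin (m + 1)))ᶜ = {0} := by
    rw [Finset.compl_erase, Finset.compl_univ]; rfl
  rw [koszulD_apply, koszulD_apply, h0, Finset.sum_singleton, Finset.sum_singleton,
    Finset.insert_erase (Finset.mem_univ _)] at ha
  have hne : koszulSign K (Finset.univ.erase (0 : Fin (m + 1))) 0 * X 0 ≠ 0 :=
    mul_ne_zero (left_ne_zero_of_mul_eq_one (koszulSign_mul_self _ _)) (X_ne_zero _)
  have := mul_left_cancel₀ hne ha
  simp only [hc, if_true] at this
  rw [← this]
  exact (hw _).1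

/-! ### Ideals with a linear non-zero-divisor on the quotient -/

/-- A homogeneous ideal whose quotient has the linear non-zero-divisor `l`, and contains all the
forms of degree `r` modulo `l`. -/
structure IsRegularMod (Q : Ideal (MvPolynomial (Fin n) K)) (l : MvPolynomial (Fin n) K)
    (r : ℕ) : Prop where
  homog : Homog Q
  linear : l.IsHomogeneous 1
  mem_of_mul_mem : ∀ f, l * f ∈ Q → f ∈ Q
  pow_le : idealOfVars (Fin n) K ^ r ≤ Q ⊔ Ideal.span {l}

/-- The $K$-linear combination of the homotopies for the variables contracts multiplication by
$\ell$ and keeps coefficients inside any given ideal. -/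
lemma exists_contraction {l : MvPolynomial (Fin n) K} (hl : l.IsHomogeneous 1) :
    ∃ h : (Finset (Fin n) → MvPolynomial (Fin n) K) → (Finset (Fin n) → MvPolynomial (Fin n) K),
      (∀ v, koszulD K n (h v) + h (koszulD K n v) = l • v) ∧
      ∀ I i s v, IsChain I i s v → IsChain I (i + 1) s (h v) := by
  obtain ⟨c, rfl⟩ := isHomogeneous_one_eq_sum hl
  refine ⟨fun v => ∑ a, (C (c a) : MvPolynomial (Fin n) K) • koszulH a v, fun v => ?_,
    fun I i s v hv => ?_⟩
  · rw [map_sum, ← Finset.sum_add_distrib, Finset.sum_smul]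
    refine Finset.sum_congr rfl fun a _ => ?_
    rw [koszulD_smul, ← smul_add, koszulD_koszulH, smul_smul]
  · refine Finset.sum_induction _ _ (fun _ _ => IsChain.add) IsChain.zero fun a _ => ?_
    have := (hv.koszulH a).smul (isHomogeneous_C (Fin n) (c a))
    rwa [zero_add] at this

lemma IsChain.exists_add_smul {Q : Ideal (MvPolynomial (Fin n) K)} (hQ : Homog Q)
    {l : MvPolynomial (Fin n) K} (hl : l.IsHomogeneous 1) {i s : ℕ}
    {c : Finset (Fin n) → MvPolynomial (Fin n) K} (hc : IsChain ⊤ i s c)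
    (h : ∀ S, c S ∈ Q ⊔ Ideal.span {l}) :
    ∃ q u, c = q + l • u ∧ IsChain Q i s q ∧ (∀ s', s = s' + 1 → IsChain ⊤ i s' u) ∧
      (s = 0 → u = 0) := by
  have : ∀ S, ∃ q g : MvPolynomial (Fin n) K, c S = q + l * g ∧ q ∈ Q ∧ q.IsHomogeneous s ∧
      (∀ s', s = s' + 1 → g.IsHomogeneous s') ∧ (s = 0 → g = 0) ∧
      (S.card ≠ i → q = 0 ∧ g = 0) := by
    intro S
    by_cases hS : S.card = i
    · obtain ⟨q, hq, g, h1, h2, h3, h4⟩ := exists_add_mul_of_mem_sup hQ hl (hc S).2.1 (h S)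
      exact ⟨q, g, h1, hq, h2, h3, h4, fun h => absurd hS h⟩
    · exact ⟨0, 0, by simp [(hc S).2.2 hS], Q.zero_mem, isHomogeneous_zero _ _ _,
        fun _ _ => isHomogeneous_zero _ _ _, fun _ => rfl, fun _ => ⟨rfl, rfl⟩⟩
  choose q u h1 h2 h3 h4 h5 h6 using this
  exact ⟨q, u, funext h1, fun S => ⟨h2 S, h3 S, fun hS => (h6 S hS).1⟩,
    fun s' hs' S => ⟨Submodule.mem_top, h4 S s' hs', fun hS => (h6 S hS).2⟩,
    fun hs => funext fun S => h5 S hs⟩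

namespace IsRegularMod

variable {Q : Ideal (MvPolynomial (Fin n) K)} {l : MvPolynomial (Fin n) K} {r : ℕ}

lemma mono (h : IsRegularMod Q l r) {r' : ℕ}
    (h' : idealOfVars (Fin n) K ^ r' ≤ Q ⊔ Ideal.span {l}) : IsRegularMod Q l r' :=
  ⟨h.homog, h.linear, h.mem_of_mul_mem, h'⟩

lemma saturation_eq (h : IsRegularMod Q l r) : saturation Q = Q := by
  refine le_antisymm (fun f hf => ?_) (le_saturation Q)
  obtain ⟨k, hk⟩ := mem_saturation.mp hf
  have key : ∀ k, l ^ k * f ∈ Q → f ∈ Q := by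
    intro k
    induction k with
    | zero => simp
    | succ k ih =>
      intro hk
      rw [pow_succ', mul_assoc] at hk
      exact ih (h.mem_of_mul_mem _ hk)
  refine key k (hk _ (mem_pow_idealOfVars_of_isHomogeneous (h.linear.pow k) ?_))
  rw [one_mul]

/-- Koszul cycles in the strands beyond `r` are boundaries. -/
lemma exists_koszulD_eq (h : IsRegularMod Q l r) {i s : ℕ} (hs : r ≤ s)
    {z : Finset (Fin n) → MvPolynomial (Fin n) K} (hz : IsChain Q i (s + 1) z)
    (hz0 : koszulD K n z = 0) : ∃ w, IsChain Q (i + 1) s w ∧ koszulD K n w = z := by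
  obtain ⟨v, hv, _, hvz⟩ := GradedIdeal.exists_koszulD_eq (hz.mono le_top) hz0
    (Or.inr (Nat.succ_ne_zero s))
  obtain ⟨q, u, rfl, hq, hu, hu0⟩ := (hv s rfl).exists_add_smul h.homog h.linear
    fun S => h.pow_le (mem_pow_idealOfVars_of_isHomogeneous (hv s rfl S).2.1 hs)
  obtain ⟨H, hH, hHc⟩ := exists_contraction h.linear
  rw [map_add, koszulD_smul] at hvz
  -- Write $z=\partial v$ over $R$ with $v=q+\ell u$. Then $\ell\,\partial u=z-\partial q$ has
  -- coefficients in $Q$, hence so has $\partial u$. Replacing $\ell u$ by $H\partial u$ keeps the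
  -- boundary, since $\partial H\partial u=\ell\,\partial u$, and moves the primitive into $Q$.
  refine ⟨H (koszulD K n u) + q, IsChain.add ?_ hq, ?_⟩
  · rcases s with _ | s
    · rw [hu0 rfl, map_zero]
      exact hHc _ _ _ _ IsChain.zero
    · refine hHc _ _ _ _ fun S => ⟨h.mem_of_mul_mem _ ?_, ((hu s rfl).koszulD S).2⟩
      have h1 := congrFun hvz S
      simp only [Pi.add_apply, Pi.smul_apply, smul_eq_mul] at h1
      rw [eq_sub_of_add_eq' h1]
      exact Q.sub_mem (hz S).1 (hq.koszulD S).1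
  · have h1 := hH (koszulD K n u)
    rw [koszulD_koszulD] at h1
    have h2 := congrArg (koszulD K n) (hH u)
    rw [map_add, koszulD_koszulD, zero_add, koszulD_smul] at h2
    rw [map_add, h2, add_comm, hvz]

lemma gradedBetti_eq_zero (h : IsRegularMod Q l r) (i s : ℕ) (hs : r < s) :
    gradedBetti Q i (i + s) = 0 := by
  obtain ⟨s, rfl⟩ := Nat.exists_eq_succ_of_ne_zero (by omega : s ≠ 0)
  exact gradedBetti_succ_eq_zero_iff.mpr fun z hz hz0 =>
    h.exists_koszulD_eq (Nat.lt_succ_iff.mp hs) hz hz0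

lemma regularity_le (h : IsRegularMod Q l r) : regularity Q ≤ r :=
  GradedIdeal.regularity_le h.gradedBetti_eq_zero

/-- The socle of $R/(Q+(\ell))$ vanishes in degrees $\ge\operatorname{reg}(Q)$. With
$c=fe_{\{1,\dots,n\}}$, the boundary is $\partial c=q+\ell g$ with $q$ in $Q$, so $\partial g$ is a
cycle in $Q$ of homological degree $n-2$. It lies beyond the regularity, and correcting $c$ by a
multiple of $\ell$ brings its whole boundary into $Q$. -/
lemma mem_sup_of_forall_X_mul_mem (h : IsRegularMod Q l r) (hn : 2 ≤ n)
    {f : MvPolynomial (Fin n) K} {e : ℕ} (he : regularity Q ≤ e) (hf : f.IsHomogeneous e)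
    (hX : ∀ a, X a * f ∈ Q ⊔ Ideal.span {l}) : f ∈ Q ⊔ Ideal.span {l} := by
  obtain ⟨m, rfl⟩ := Nat.exists_eq_add_of_le' hn
  set c : Finset (Fin (m + 2)) → MvPolynomial (Fin (m + 2)) K :=
    fun S => if S = Finset.univ then f else 0 with hc
  have hchain : IsChain ⊤ (m + 2) e c := by
    refine fun S => ⟨Submodule.mem_top, ?_, fun hS => if_neg ?_⟩
    · simp only [hc]
      split_ifs
      · exact hf
      · exact isHomogeneous_zero _ _ _
    · rintro rfl
      simp at hS
  obtain ⟨q, g, hqg, hq, hg, -⟩ := (IsChain.koszulD (i := m + 1) hchain).exists_add_smul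
    h.homog h.linear (by
      intro T
      rw [koszulD_apply]
      refine Ideal.sum_mem _ fun a _ => ?_
      rw [mul_assoc]
      refine Ideal.mul_mem_left _ _ ?_
      simp only [hc]
      split_ifs
      · exact hX a
      · rw [mul_zero]; exact Ideal.zero_mem _)
  have hg := hg e rfl
  have hDg : IsChain Q m (e + 1) (koszulD K (m + 2) g) := by
    refine fun T => ⟨h.mem_of_mul_mem _ ?_, (IsChain.koszulD (i := m) hg T).2⟩
    have h1 := congrFun (congrArg (koszulD K (m + 2)) hqg) T
    rw [koszulD_koszulD, map_add, koszulD_smul] at h1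
    simp only [Pi.add_apply, Pi.smul_apply, smul_eq_mul, Pi.zero_apply] at h1
    rw [eq_neg_of_add_eq_zero_right h1.symm]
    exact Q.neg_mem (hq.koszulD T).1
  have hb := gradedBetti_eq_zero_of_regularity_lt (i := m) (s := e + 1)
    (bddAbove_of_gradedBetti h.gradedBetti_eq_zero) (by omega)
  obtain ⟨q', hq', hDq'⟩ := gradedBetti_succ_eq_zero_iff.mp hb _ hDg (koszulD_koszulD g)
  -- The cycle $g-q'$ has homological degree $n-1\ge1$, so acyclicity over $R$ applies whatever its
  -- coefficient degree.
  obtain ⟨u, -, -, hu⟩ := GradedIdeal.exists_koszulD_eq (hg.sub (hq'.mono le_top))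
    (by rw [map_sub, hDq', sub_self]) (Or.inl (Nat.succ_ne_zero m))
  have hfin : koszulD K (m + 2) (c - l • u) = q + l • q' := by
    rw [map_sub, koszulD_smul, hu, hqg, smul_sub]
    abel
  -- All $x_a(f-\ell u)$ lie in $Q$, hence so does $\ell(f-\ell u)$, and $\ell$ can be cancelled.
  have hmem : f - l * u Finset.univ ∈ Q := by
    refine h.mem_of_mul_mem _ (mul_mem_of_forall_X_mul_mem h.linear fun a => ?_)
    have h1 := congrFun hfin (Finset.univ.erase a)
    have h0 : (Finset.univ.erase a)ᶜ = {a} := by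
      rw [Finset.compl_erase, Finset.compl_univ]; rfl
    rw [koszulD_apply, h0, Finset.sum_singleton, Finset.insert_erase (Finset.mem_univ _)] at h1
    simp only [hc, Pi.sub_apply, Pi.smul_apply, smul_eq_mul, if_true, Pi.add_apply] at h1
    have h2 : X a * (f - l * u Finset.univ) = koszulSign K (Finset.univ.erase a) a *
        (q (Finset.univ.erase a) + l * q' (Finset.univ.erase a)) := by
      rw [← h1]
      linear_combination (-(X a * (f - l * u Finset.univ))) *
        koszulSign_mul_self (K := K) (Finset.univ.erase a) a
    rw [h2]
    exact Q.mul_mem_left _ (Q.add_mem (hq _).1 (Q.mul_mem_left _ (hq' _).1))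
  rw [← sub_add_cancel f (l * u Finset.univ)]
  exact add_mem (Ideal.mem_sup_left hmem) (Ideal.mem_sup_right
    (Ideal.mul_mem_right _ _ (Ideal.mem_span_singleton_self l)))

/-- Descending induction on the exponent, from one where the inclusion is known: the absence of
socle lowers it step by step to $\operatorname{reg}(Q)$. -/
lemma pow_regularity_le (h : IsRegularMod Q l r) (hn : 2 ≤ n) :
    idealOfVars (Fin n) K ^ regularity Q ≤ Q ⊔ Ideal.span {l} := by
  have key : ∀ j, idealOfVars (Fin n) K ^ (regularity Q + j) ≤ Q ⊔ Ideal.span {l} →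
      idealOfVars (Fin n) K ^ regularity Q ≤ Q ⊔ Ideal.span {l} := by
    intro j
    induction j with
    | zero => exact id
    | succ j ih =>
      intro hj
      refine ih (pow_idealOfVars_le_iff.mpr fun f hf => ?_)
      refine h.mem_sup_of_forall_X_mul_mem hn (Nat.le_add_right _ _) hf fun a => ?_
      exact hj (mem_pow_idealOfVars_of_isHomogeneous ((isHomogeneous_X K a).mul hf) (by omega))
  exact key r ((Ideal.pow_le_pow_right (Nat.le_add_left _ _)).trans h.pow_le)

end IsRegularMod

/-! ### Truncations -/

lemma componentIdeal_le (I : Ideal (MvPolynomial (Fin n) K)) (d : ℕ) :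
    componentIdeal I d ≤ I :=
  Ideal.span_le.mpr fun _ hf => (mem_component.mp hf).1

lemma componentIdeal_le_pow (I : Ideal (MvPolynomial (Fin n) K)) (d : ℕ) :
    componentIdeal I d ≤ idealOfVars (Fin n) K ^ d :=
  Ideal.span_le.mpr fun _ hf =>
    mem_pow_idealOfVars_of_isHomogeneous (mem_component.mp hf).2 le_rfl

lemma component_le_componentIdeal (I : Ideal (MvPolynomial (Fin n) K)) (d : ℕ) :
    component I d ≤ (componentIdeal I d).restrictScalars K :=
  fun _ hf => Ideal.subset_span hf

lemma component_componentIdeal_self (I : Ideal (MvPolynomial (Fin n) K)) (d : ℕ) :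
    component (componentIdeal I d) d = component I d :=
  le_antisymm (component_mono (componentIdeal_le I d) d) fun _ hf =>
    mem_component.mpr ⟨component_le_componentIdeal I d hf, (mem_component.mp hf).2⟩

lemma eq_zero_of_mem_pow_of_isHomogeneous {f : MvPolynomial (Fin n) K} {d e : ℕ}
    (h : f ∈ idealOfVars (Fin n) K ^ d) (hf : f.IsHomogeneous e) (he : e < d) : f = 0 := by
  rw [← support_eq_empty, Finset.eq_empty_iff_forall_notMem]
  intro m hm
  have h1 := (mem_pow_idealOfVars_iff d f).mp h m hm
  have h2 := (isHomogeneous_iff_degree f e).mp hf m hm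
  omega

lemma component_eq_bot_of_le_pow {I : Ideal (MvPolynomial (Fin n) K)} {d e : ℕ}
    (h : I ≤ idealOfVars (Fin n) K ^ d) (he : e < d) : component I e = ⊥ :=
  (Submodule.eq_bot_iff _).mpr fun _ hf =>
    eq_zero_of_mem_pow_of_isHomogeneous (h (mem_component.mp hf).1) (mem_component.mp hf).2 he

lemma initialDegree_eq {I : Ideal (MvPolynomial (Fin n) K)} {d : ℕ}
    (h : I ≤ idealOfVars (Fin n) K ^ d) (hd : component I d ≠ ⊥) : initialDegree I = d := by
  refine le_antisymm (Nat.sInf_le hd) (le_csInf ⟨d, hd⟩ fun e he => ?_)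
  by_contra hlt
  exact he (component_eq_bot_of_le_pow h (not_le.mp hlt))

/-- A non-zero form of lowest degree is a cycle of homological degree $0$; it cannot be a boundary,
as a primitive would have coefficients of smaller degree in $I$. -/
lemma le_regularity {I : Ideal (MvPolynomial (Fin n) K)} {d r : ℕ}
    (hI : ∀ i s, r < s → gradedBetti I i (i + s) = 0)
    (h : I ≤ idealOfVars (Fin n) K ^ d) (hd : component I d ≠ ⊥) : d ≤ regularity I := by
  by_contra hlt
  have hb := gradedBetti_eq_zero_of_regularity_lt (i := 0) (bddAbove_of_gradedBetti hI)
    (not_le.mp hlt)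
  obtain ⟨f, hf, hf0⟩ := Submodule.exists_mem_ne_zero_of_ne_bot hd
  obtain ⟨hfI, hfd⟩ := mem_component.mp hf
  obtain ⟨s, rfl⟩ : ∃ s, d = s + 1 := Nat.exists_eq_succ_of_ne_zero (by omega)
  have hz : IsChain I 0 (s + 1) (fun S => if S = ∅ then f else 0) := by
    intro S
    dsimp only
    split_ifs with hS
    · exact ⟨hfI, hfd, fun h => absurd (by rw [hS, Finset.card_empty]) h⟩
    · exact ⟨I.zero_mem, isHomogeneous_zero _ _ _, fun _ => rfl⟩
  obtain ⟨w, hw, hwz⟩ := gradedBetti_succ_eq_zero_iff.mp hb _ hz hz.koszulD_eq_zero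
  have hw0 : w = 0 := funext fun S =>
    eq_zero_of_mem_pow_of_isHomogeneous (h (hw S).1) (hw S).2.1 (Nat.lt_succ_self s)
  rw [hw0, map_zero] at hwz
  have := congrFun hwz ∅
  simp only [Pi.zero_apply, if_true] at this
  exact hf0 this.symm

namespace IsRegularMod

variable {Q : Ideal (MvPolynomial (Fin n) K)} {l : MvPolynomial (Fin n) K} {d : ℕ}

lemma mem_componentIdeal (h : IsRegularMod Q l d) {f : MvPolynomial (Fin n) K} {e : ℕ}
    (he : d ≤ e) (hf : f.IsHomogeneous e) (hfQ : f ∈ Q) : f ∈ componentIdeal Q d := by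
  induction e, he using Nat.le_induction generalizing f with
  | base => exact component_le_componentIdeal Q d (mem_component.mpr ⟨hfQ, hf⟩)
  | succ s hs ih =>
    have hz : IsChain Q 0 (s + 1) (fun S => if S = ∅ then f else 0) := by
      intro S
      dsimp only
      split_ifs with hS
      · exact ⟨hfQ, hf, fun h => absurd (by rw [hS, Finset.card_empty]) h⟩
      · exact ⟨Q.zero_mem, isHomogeneous_zero _ _ _, fun _ => rfl⟩
    -- A form of $Q$ of degree above $d$ is a cycle of homological degree $0$; being a boundary, it
    -- equals $\sum\pm x_a w_a$ with $w_a\in Q$ of one degree less.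
    obtain ⟨w, hw, hwz⟩ := h.exists_koszulD_eq hs hz hz.koszulD_eq_zero
    have := congrFun hwz ∅
    simp only [if_true, koszulD_apply] at this
    rw [← this]
    exact Ideal.sum_mem _ fun a _ => Ideal.mul_mem_left _ _ (ih (hw _).2.1 (hw _).1)

lemma saturation_componentIdeal (h : IsRegularMod Q l d) :
    saturation (componentIdeal Q d) = Q := by
  refine le_antisymm ((saturation_mono (componentIdeal_le Q d)).trans h.saturation_eq.le)
    -- The exponent $d$ suffices: $\mathfrak m^dQ$ lives in degrees $\ge d$, where $Q$ and its
    -- truncation agree.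
    fun f hf => mem_saturation.mpr ⟨d, fun u hu => ?_⟩
  rw [(homog_componentIdeal Q d).mem_iff]
  intro e
  have h1 : u * f ∈ idealOfVars (Fin n) K ^ d := Ideal.mul_mem_right _ _ hu
  have h2 := homogeneousComponent_isHomogeneous e (u * f)
  rcases lt_or_ge e d with he | he
  · rw [eq_zero_of_mem_pow_of_isHomogeneous
      (homog_iff.mp (homog_pow_idealOfVars d) _ h1 e) h2 he]
    exact Ideal.zero_mem _
  · exact h.mem_componentIdeal he h2 (homog_iff.mp h.homog _ (Q.mul_mem_left u hf) e)

lemma gradedBetti_componentIdeal_eq_zero (h : IsRegularMod Q l d) (i s : ℕ) (hs : d < s) :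
    gradedBetti (componentIdeal Q d) i (i + s) = 0 := by
  obtain ⟨s, rfl⟩ := Nat.exists_eq_succ_of_ne_zero (by omega : s ≠ 0)
  refine gradedBetti_succ_eq_zero_iff.mpr fun z hz hz0 => ?_
  obtain ⟨w, hw, hwz⟩ := h.exists_koszulD_eq (Nat.lt_succ_iff.mp hs)
    (hz.mono (componentIdeal_le Q d)) hz0
  exact ⟨w, fun S => ⟨h.mem_componentIdeal (Nat.lt_succ_iff.mp hs) (hw S).2.1 (hw S).1,
    (hw S).2⟩, hwz⟩

lemma hasLinearResolution_componentIdeal (h : IsRegularMod Q l d) :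
    HasLinearResolution (componentIdeal Q d) := by
  by_cases h0 : component Q d = ⊥
  · left
    rw [componentIdeal, h0]
    exact Ideal.span_eq_bot.mpr fun x hx => hx
  · right
    rw [← component_componentIdeal_self] at h0
    have hle := componentIdeal_le_pow Q d
    rw [initialDegree_eq hle h0]
    exact le_antisymm (GradedIdeal.regularity_le h.gradedBetti_componentIdeal_eq_zero)
      (le_regularity h.gradedBetti_componentIdeal_eq_zero hle h0)

/-- As $n\ge2$, $\ell$ vanishes at some point $p$ with a coordinate $p_b\ne0$. If $Q_d=0$, then
$x_b^d\in(\ell)$, which fails at $p$. -/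
lemma component_ne_bot (h : IsRegularMod Q l d) (hn : 2 ≤ n) : component Q d ≠ ⊥ := by
  intro h0
  obtain ⟨c, hc⟩ := isHomogeneous_one_eq_sum h.linear
  obtain ⟨p, b, hb, hp⟩ : ∃ (p : Fin n → K) (b : Fin n), p b ≠ 0 ∧ eval p l = 0 := by
    let i : Fin n := ⟨0, by omega⟩
    let j : Fin n := ⟨1, by omega⟩
    have hij : i ≠ j := by simp [i, j]
    have hev : ∀ p : Fin n → K, eval p l = ∑ a, c a * p a := by
      intro p; rw [hc]; simp
    by_cases hi : c i = 0
    · refine ⟨Pi.single i 1, i, by simp, ?_⟩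
      rw [hev, Finset.sum_eq_single_of_mem i (Finset.mem_univ _)
        (fun b _ hb => by simp [Pi.single_eq_of_ne hb])]
      simp [hi]
    · refine ⟨Pi.single i (-c j) + Pi.single j (c i), j, by simp [hij.symm, hi], ?_⟩
      rw [hev]
      simp only [Pi.add_apply, mul_add, Finset.sum_add_distrib, Pi.single_apply, mul_ite,
        mul_zero, Finset.sum_ite_eq', Finset.mem_univ, if_true]
      ring
  have hX : (X b ^ d : MvPolynomial (Fin n) K).IsHomogeneous d := by
    simpa using (isHomogeneous_X K b).pow d
  obtain ⟨q, hq, g, hqg, hqd, -⟩ := exists_add_mul_of_mem_sup h.homog h.linear hX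
    (h.pow_le (mem_pow_idealOfVars_of_isHomogeneous hX le_rfl))
  have hq0 : q = 0 := by
    have := mem_component.mpr ⟨hq, hqd⟩
    rwa [h0, Submodule.mem_bot] at this
  have := congrArg (eval p) hqg
  rw [hq0, zero_add, map_mul, hp, zero_mul, map_pow, eval_X] at this
  exact pow_ne_zero d hb this

end IsRegularMod

/-- If `I_⟨d⟩` has a linear resolution, then it agrees with its saturation in degrees `≥ d`. -/
lemma component_saturation_componentIdeal {I : Ideal (MvPolynomial (Fin n) K)} (hn : n ≠ 0)
    {d : ℕ} (h : HasLinearResolution (componentIdeal I d)) (hd : component I d ≠ ⊥) {e : ℕ}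
    (he : d ≤ e) :
    component (saturation (componentIdeal I d)) e = component (componentIdeal I d) e := by
  set J := componentIdeal I d with hJ
  have hJd : component J d ≠ ⊥ := by rwa [hJ, component_componentIdeal_self]
  have hreg : regularity J = d := by
    rcases h with h | h
    · refine absurd ?_ hJd
      rw [h]
      exact (Submodule.eq_bot_iff _).mpr fun f hf => by simpa using (mem_component.mp hf).1
    · rw [h, initialDegree_eq (componentIdeal_le_pow I d) hJd]
  refine le_antisymm (fun f hf => ?_) (component_mono (le_saturation J) e)
  obtain ⟨hfs, hfe⟩ := mem_component.mp hf
  refine mem_component.mpr ⟨?_, hfe⟩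
  -- For $d=0$ the value $\operatorname{reg}=0$ might come from an unbounded supremum, but then $J$
  -- contains a unit. For $d>0$ a non-zero value proves boundedness.
  rcases Nat.eq_zero_or_pos d with rfl | hpos
  · obtain ⟨g, hg, hg0⟩ := Submodule.exists_mem_ne_zero_of_ne_bot hJd
    obtain ⟨hgJ, hg1⟩ := mem_component.mp hg
    rw [← mem_homogeneousSubmodule, homogeneousSubmodule_zero, Submodule.mem_one] at hg1
    obtain ⟨x, rfl⟩ := hg1
    have hx : x ≠ 0 := fun h => hg0 (by rw [h, map_zero])
    rw [(Ideal.eq_top_iff_one J).mpr ?_]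
    · trivial
    · have := J.mul_mem_left (C x⁻¹) hgJ
      rwa [algebraMap_eq, ← C_mul, inv_mul_cancel₀ hx, C_1] at this
  · have hb : BddAbove {r | ∃ i j : ℕ, gradedBetti J i j ≠ 0 ∧ r + i = j} := by
      by_contra hb
      have := Nat.sSup_of_not_bddAbove hb
      rw [regularity, this] at hreg
      omega
    refine mem_of_mem_saturation (d := d) (fun g e' he' hg hX => ?_) he hfe hfs
    exact mem_of_forall_X_mul_mem hn (fun i s hs => gradedBetti_eq_zero_of_regularity_lt hb
      (by omega)) he' hg hX

/-! ### Finite colength, dimension, and linear non-zero-divisors -/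

/-- In the Artinian quotient the powers of $\mathfrak m$ stabilize, so $\mathfrak m^k\subseteq
I+\mathfrak m^{k+1}$; degree-$k$ parts then give $\mathfrak m^k\subseteq I$. -/
lemma exists_pow_le_of_finite {I : Ideal (MvPolynomial (Fin n) K)} (hI : Homog I)
    [Module.Finite K (MvPolynomial (Fin n) K ⧸ I)] : ∃ k, idealOfVars (Fin n) K ^ k ≤ I := by
  have hA : IsArtinianRing (MvPolynomial (Fin n) K ⧸ I) :=
    (Module.finite_iff_isArtinianRing K _).mp inferInstance
  let g : ℕ →o (Ideal (MvPolynomial (Fin n) K ⧸ I))ᵒᵈ :=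
    ⟨fun k => OrderDual.toDual ((idealOfVars (Fin n) K ^ k).map (Ideal.Quotient.mk I)),
      fun k k' hk => Ideal.map_mono (Ideal.pow_le_pow_right hk)⟩
  obtain ⟨k, hk⟩ := IsArtinian.monotone_stabilizes g
  have hk : (idealOfVars (Fin n) K ^ k).map (Ideal.Quotient.mk I) =
      (idealOfVars (Fin n) K ^ (k + 1)).map (Ideal.Quotient.mk I) :=
    OrderDual.toDual.injective (hk (k + 1) (Nat.le_succ k))
  refine ⟨k, pow_idealOfVars_le_iff.mpr fun f hf => ?_⟩
  have h1 : Ideal.Quotient.mk I f ∈ (idealOfVars (Fin n) K ^ (k + 1)).map (Ideal.Quotient.mk I) :=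
    hk ▸ Ideal.mem_map_of_mem _ (mem_pow_idealOfVars_of_isHomogeneous hf le_rfl)
  obtain ⟨g, hg, hgf⟩ := (Ideal.mem_map_iff_of_surjective _ Ideal.Quotient.mk_surjective).mp h1
  have h2 := homog_iff.mp hI _ (Ideal.Quotient.eq.mp hgf) k
  rw [map_sub, homogeneousComponent_eq_self hf,
    eq_zero_of_mem_pow_of_isHomogeneous (homog_iff.mp (homog_pow_idealOfVars (k + 1)) _ hg k)
      (homogeneousComponent_isHomogeneous _ _) (Nat.lt_succ_self k), zero_sub] at h2
  exact neg_mem_iff.mp h2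

lemma finite_of_pow_le {I : Ideal (MvPolynomial (Fin n) K)} {k : ℕ}
    (h : idealOfVars (Fin n) K ^ k ≤ I) : Module.Finite K (MvPolynomial (Fin n) K ⧸ I) := by
  refine ⟨Submodule.fg_def.mpr ⟨(fun m : Fin n →₀ ℕ => Ideal.Quotient.mk I (monomial m 1)) ''
    {m | m.degree < k}, (Finsupp.finite_of_degree_lt k).image _, ?_⟩⟩
  rw [eq_top_iff]
  rintro x -
  obtain ⟨f, rfl⟩ := Ideal.Quotient.mk_surjective x
  rw [f.as_sum, map_sum]
  refine Submodule.sum_mem _ fun m _ => ?_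
  rcases lt_or_ge m.degree k with hm | hm
  · have : Ideal.Quotient.mk I (monomial m (coeff m f)) =
        coeff m f • Ideal.Quotient.mk I (monomial m 1) := by
      rw [← Ideal.Quotient.mkₐ_eq_mk K, ← map_smul, smul_monomial, smul_eq_mul, mul_one]
    rw [this]
    exact Submodule.smul_mem _ _ (Submodule.subset_span ⟨m, hm, rfl⟩)
  · rw [Ideal.Quotient.eq_zero_iff_mem.mpr
      (h (mem_pow_idealOfVars_of_isHomogeneous (isHomogeneous_monomial _ rfl) hm))]
    exact Submodule.zero_mem _

lemma ringKrullDim_quotient_sup_succ_le {Q : Ideal (MvPolynomial (Fin n) K)}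
    {l : MvPolynomial (Fin n) K} (h : ∀ f, l * f ∈ Q → f ∈ Q) :
    ringKrullDim (MvPolynomial (Fin n) K ⧸ Q ⊔ Ideal.span {l}) + 1 ≤
      ringKrullDim (MvPolynomial (Fin n) K ⧸ Q) := by
  have hl : Ideal.Quotient.mk Q l ∈ nonZeroDivisors (MvPolynomial (Fin n) K ⧸ Q) := by
    rw [mem_nonZeroDivisors_iff_right]
    intro x hx
    obtain ⟨f, rfl⟩ := Ideal.Quotient.mk_surjective x
    rw [← map_mul, Ideal.Quotient.eq_zero_iff_mem] at hx
    exact Ideal.Quotient.eq_zero_iff_mem.mpr (h f (by rwa [mul_comm]))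
  have h1 := ringKrullDim_quotient_succ_le_of_nonZeroDivisor hl
  rwa [← Set.image_singleton, ← Ideal.map_span,
    ringKrullDim_eq_of_ringEquiv (DoubleQuot.quotQuotEquivQuotSup _ _)] at h1

lemma exists_pow_le_of_ringKrullDim {Q : Ideal (MvPolynomial (Fin n) K)} (hQ : Homog Q)
    {l : MvPolynomial (Fin n) K} (hl : l.IsHomogeneous 1) (h : ∀ f, l * f ∈ Q → f ∈ Q)
    (hdim : ringKrullDim (MvPolynomial (Fin n) K ⧸ Q) = 1) :
    ∃ r, idealOfVars (Fin n) K ^ r ≤ Q ⊔ Ideal.span {l} := by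
  have h1 := ringKrullDim_quotient_sup_succ_le h
  rw [hdim] at h1
  have : Ring.KrullDimLE 0 (MvPolynomial (Fin n) K ⧸ Q ⊔ Ideal.span {l}) := by
    rw [Ring.krullDimLE_iff]
    have h2 : ringKrullDim (MvPolynomial (Fin n) K ⧸ Q ⊔ Ideal.span {l}) + 1 ≤ 0 + 1 := by
      rwa [zero_add]
    exact ENat.WithBot.add_le_add_one_right_iff.mp h2
  have : Module.Finite K (MvPolynomial (Fin n) K ⧸ Q ⊔ Ideal.span {l}) :=
    (Module.finite_iff_krullDimLE_zero K _).mpr this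
  exact exists_pow_le_of_finite (hQ.sup (homog_span fun f hf => ⟨1, by rwa [hf]⟩))

/-- A linear form is a non-zero-divisor modulo a saturated ideal if its residue ring is
of finite length. -/
lemma mem_of_mul_mem_of_saturation_eq {Q : Ideal (MvPolynomial (Fin n) K)}
    {l : MvPolynomial (Fin n) K} (hsat : saturation Q = Q) {r : ℕ}
    (hr : idealOfVars (Fin n) K ^ r ≤ Q ⊔ Ideal.span {l}) {f : MvPolynomial (Fin n) K}
    (hf : l * f ∈ Q) : f ∈ Q := by
  let g : ℕ →o Ideal (MvPolynomial (Fin n) K) :=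
    ⟨fun k => Q.colon {l ^ k}, fun k k' hk x hx => by
      rw [Submodule.mem_colon_singleton, smul_eq_mul] at hx ⊢
      rw [← Nat.add_sub_cancel' hk, pow_add, ← mul_assoc]
      exact Q.mul_mem_right _ hx⟩
  obtain ⟨k, hk⟩ := monotone_stabilizes_iff_noetherian.mpr inferInstance g
  have hk : Q.colon {l ^ k} = Q.colon {l ^ (k + 1)} := hk (k + 1) (Nat.le_succ k)
  rw [← hsat]
  -- With $Q:\ell^k=Q:\ell^{k+1}$, the exponent comes from $(Q+(\ell))^{1+k}\subseteq Q+(\ell^k)$.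
  -- Writing $u=q+v\ell^k$, the hypothesis gives $v\ell^{k+1}f\in Q$, hence $v\ell^kf\in Q$ and
  -- $uf\in Q$.
  refine mem_saturation.mpr ⟨r * (1 + k), fun u hu => ?_⟩
  have h1 : idealOfVars (Fin n) K ^ (r * (1 + k)) ≤ Q ⊔ Ideal.span {l ^ k} := by
    rw [pow_mul, ← Ideal.span_singleton_pow]
    refine (Ideal.pow_right_mono hr _).trans (Ideal.sup_pow_add_le_pow_sup_pow.trans ?_)
    rw [pow_one]
  obtain ⟨q, hq, y, hy, hqy⟩ := Submodule.mem_sup.mp (h1 hu)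
  obtain ⟨v, rfl⟩ := Ideal.mem_span_singleton'.mp hy
  have h2 : v * f ∈ Q.colon {l ^ (k + 1)} := by
    rw [Submodule.mem_colon_singleton, smul_eq_mul]
    have h3 := Q.sub_mem (Q.mul_mem_left u hf) (Q.mul_mem_right (l * f) hq)
    rw [← hqy] at h3
    convert h3 using 1
    ring
  rw [← hk, Submodule.mem_colon_singleton, smul_eq_mul] at h2
  have h3 := Q.add_mem (Q.mul_mem_right f hq) h2
  rw [← hqy]
  convert h3 using 1
  ring

lemma Homog.le_idealOfVars {Q : Ideal (MvPolynomial (Fin n) K)} (hQ : Homog Q) (h : Q ≠ ⊤) :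
    Q ≤ idealOfVars (Fin n) K ^ 1 := by
  intro f hf
  rw [mem_pow_idealOfVars_iff']
  intro m hm
  obtain rfl : m = 0 := (Finsupp.degree_eq_zero_iff m).mp (by omega)
  have h0 := homog_iff.mp hQ f hf 0
  rw [homogeneousComponent_zero] at h0
  by_contra hne
  refine h ((Ideal.eq_top_iff_one Q).mpr ?_)
  have := Q.mul_mem_left (C (coeff 0 f)⁻¹) h0
  rwa [← C_mul, inv_mul_cancel₀ hne, C_1] at this

/-- By incomparability for integral extensions, contraction of primes to $K[t]$ is strictly
monotone. -/
lemma krullDim_le_one_of_isIntegral_aeval {A : Type*} [CommRing A] [Algebra K A] (x : A)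
    (h : (Polynomial.aeval (R := K) x).toRingHom.IsIntegral) : ringKrullDim A ≤ 1 := by
  let := (Polynomial.aeval (R := K) x).toRingHom.toAlgebra
  have : Algebra.IsIntegral (Polynomial K) A := ⟨h⟩
  rw [← IsPrincipalIdealRing.ringKrullDim_eq_one (Polynomial K) (Polynomial.not_isField K)]
  exact Order.krullDim_le_of_strictMono (PrimeSpectrum.comap (algebraMap (Polynomial K) A))
    fun P P' hP => Ideal.IsIntegral.comap_lt_comap (I := P.asIdeal) (J := P'.asIdeal) hP

/-- A Noether normalization: modulo $Q$, every form of degree $\ge r$ is a multiple of $\ell$, so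
the monomials of degree $<r$ generate $R/Q$ over $K[\ell]$. -/
lemma IsRegularMod.isIntegral_aeval {Q : Ideal (MvPolynomial (Fin n) K)}
    {l : MvPolynomial (Fin n) K} {r : ℕ} (h : IsRegularMod Q l r) :
    (Polynomial.aeval (R := K) (Ideal.Quotient.mk Q l)).toRingHom.IsIntegral := by
  let := (Polynomial.aeval (R := K) (Ideal.Quotient.mk Q l)).toRingHom.toAlgebra
  have hsmul : ∀ (p : Polynomial K) (x : MvPolynomial (Fin n) K ⧸ Q),
      p • x = Polynomial.aeval (Ideal.Quotient.mk Q l) p * x := fun _ _ => rfl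
  set N : Submodule (Polynomial K) (MvPolynomial (Fin n) K ⧸ Q) := Submodule.span _
    ((fun m : Fin n →₀ ℕ => Ideal.Quotient.mk Q (monomial m 1)) '' {m | m.degree < r}) with hN
  have hlow : ∀ e (f : MvPolynomial (Fin n) K), e < r → f.IsHomogeneous e →
      Ideal.Quotient.mk Q f ∈ N := by
    intro e f he hf
    rw [f.as_sum, map_sum]
    refine Submodule.sum_mem _ fun m hm => ?_
    have : Ideal.Quotient.mk Q (monomial m (coeff m f)) =
        (Polynomial.C (coeff m f)) • Ideal.Quotient.mk Q (monomial m 1) := by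
      rw [hsmul, Polynomial.aeval_C, ← Algebra.smul_def, ← Ideal.Quotient.mkₐ_eq_mk K,
        ← map_smul, smul_monomial, smul_eq_mul, mul_one]
    rw [this]
    refine Submodule.smul_mem _ _ (Submodule.subset_span ⟨m, ?_, rfl⟩)
    rwa [Set.mem_ofPred_eq, (isHomogeneous_iff_degree f e).mp hf m hm]
  have key : ∀ e (f : MvPolynomial (Fin n) K), f.IsHomogeneous e →
      Ideal.Quotient.mk Q f ∈ N := by
    intro e
    induction e with
    | zero =>
      intro f hf
      rcases Nat.eq_zero_or_pos r with rfl | hr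
      · obtain ⟨q, hq, g, rfl, -, -, hg0⟩ := exists_add_mul_of_mem_sup h.homog h.linear hf
          (h.pow_le (mem_pow_idealOfVars_of_isHomogeneous hf le_rfl))
        rw [hg0 rfl, mul_zero, add_zero, Ideal.Quotient.eq_zero_iff_mem.mpr hq]
        exact N.zero_mem
      · exact hlow 0 f hr hf
    | succ e ih =>
      intro f hf
      rcases lt_or_ge (e + 1) r with he | he
      · exact hlow _ f he hf
      · obtain ⟨q, hq, g, rfl, -, hg, -⟩ := exists_add_mul_of_mem_sup h.homog h.linear hf
          (h.pow_le (mem_pow_idealOfVars_of_isHomogeneous hf he))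
        rw [map_add, Ideal.Quotient.eq_zero_iff_mem.mpr hq, zero_add, map_mul]
        have := N.smul_mem Polynomial.X (ih g (hg e rfl))
        rwa [hsmul, Polynomial.aeval_X] at this
  have hfin : Module.Finite (Polynomial K) (MvPolynomial (Fin n) K ⧸ Q) := by
    refine ⟨Submodule.fg_def.mpr ⟨_, (Finsupp.finite_of_degree_lt r).image
      (fun m : Fin n →₀ ℕ => Ideal.Quotient.mk Q (monomial m 1)), ?_⟩⟩
    rw [eq_top_iff]
    rintro x -
    obtain ⟨f, rfl⟩ := Ideal.Quotient.mk_surjective x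
    rw [← sum_homogeneousComponent f, map_sum]
    exact Submodule.sum_mem _ fun e _ => key e _ (homogeneousComponent_isHomogeneous e f)
  exact (Algebra.IsIntegral.of_finite (Polynomial K) (MvPolynomial (Fin n) K ⧸ Q)).isIntegral

lemma IsRegularMod.ringKrullDim_eq_one {Q : Ideal (MvPolynomial (Fin n) K)}
    {l : MvPolynomial (Fin n) K} {r : ℕ} (h : IsRegularMod Q l r) (hQ : Q ≠ ⊤) :
    ringKrullDim (MvPolynomial (Fin n) K ⧸ Q) = 1 := by
  refine le_antisymm (krullDim_le_one_of_isIntegral_aeval _ h.isIntegral_aeval) ?_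
  refine le_trans ?_ (ringKrullDim_quotient_sup_succ_le h.mem_of_mul_mem)
  have hne : Q ⊔ Ideal.span {l} ≠ ⊤ := by
    have hle : Q ⊔ Ideal.span {l} ≤ idealOfVars (Fin n) K ^ 1 :=
      sup_le (h.homog.le_idealOfVars hQ) ((Ideal.span_singleton_le_iff_mem _).mpr
        (mem_pow_idealOfVars_of_isHomogeneous h.linear le_rfl))
    intro htop
    have := hle (htop ▸ Submodule.mem_top : (1 : MvPolynomial (Fin n) K) ∈ _)
    exact one_ne_zero (eq_zero_of_mem_pow_of_isHomogeneous this (isHomogeneous_one _ _)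
      zero_lt_one)
  have := Ideal.Quotient.nontrivial_iff.mpr hne
  exact le_add_of_nonneg_left ringKrullDim_nonneg_of_nontrivial

/-- Prime avoidance on linear forms: an associated prime $Q:f$ containing all of them would put $f$
in $Q^{\mathrm{sat}}=Q$. So finitely many proper subspaces must be avoided, which is possible over
an infinite field. -/
lemma exists_linear_nonZeroDivisor [Infinite K] (hn : n ≠ 0)
    {s : Set (Ideal (MvPolynomial (Fin n) K))} (hs : s.Finite)
    (h : ∀ Q ∈ s, saturation Q = Q) :
    ∃ l : MvPolynomial (Fin n) K, l.IsHomogeneous 1 ∧ l ≠ 0 ∧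
      ∀ Q ∈ s, ∀ f, l * f ∈ Q → f ∈ Q := by
  classical
  let V := homogeneousSubmodule (Fin n) K 1
  have hV : ∃ v : V, v ≠ 0 := by
    refine ⟨⟨X ⟨0, Nat.pos_of_ne_zero hn⟩, isHomogeneous_X _ _⟩, fun h => ?_⟩
    exact X_ne_zero (R := K) _ (congrArg Subtype.val h)
  have hP : (⋃ Q ∈ s, associatedPrimes (MvPolynomial (Fin n) K)
      (MvPolynomial (Fin n) K ⧸ Q)).Finite :=
    hs.biUnion fun Q _ => associatedPrimes.finite _ _
  -- The zero subspace is added to the list to force $\ell\ne0$.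
  let t : Finset (Subspace K V) := insert ⊥
    (hP.toFinset.image fun P => (P.restrictScalars K).comap V.subtype)
  have ht : ⊤ ∉ t := by
    intro htop
    rcases Finset.mem_insert.mp htop with h0 | h0
    · obtain ⟨v, hv⟩ := hV
      exact hv ((Submodule.mem_bot K).mp (h0 ▸ Submodule.mem_top))
    · obtain ⟨P, hPm, hPtop⟩ := Finset.mem_image.mp h0
      simp only [Set.Finite.mem_toFinset, Set.mem_iUnion] at hPm
      obtain ⟨Q, hQ, hPQ⟩ := hPm
      obtain ⟨hprime, x, hx⟩ := isAssociatedPrime_iff.mp hPQ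
      obtain ⟨f, rfl⟩ := Ideal.Quotient.mk_surjective x
      have hmem : ∀ u, u ∈ P ↔ u * f ∈ Q := by
        intro u
        rw [hx, Submodule.mem_colon_singleton, Submodule.mem_bot, ← Ideal.Quotient.eq_zero_iff_mem,
          map_mul]
        rfl
      refine hprime.ne_top ((Ideal.eq_top_iff_one P).mpr ((hmem 1).mpr ?_))
      rw [one_mul, ← h Q hQ]
      refine mem_saturation.mpr ⟨1, ?_⟩
      have hle : idealOfVars (Fin n) K ^ 1 ≤ P := by
        rw [pow_idealOfVars_le_iff]
        intro u hu
        have : (⟨u, hu⟩ : V) ∈ (P.restrictScalars K).comap V.subtype := by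
          rw [hPtop]
          exact Submodule.mem_top
        exact this
      exact fun u hu => (hmem u).mp (hle hu)
  obtain ⟨v, hv⟩ := (Set.ne_univ_iff_exists_notMem _).mp
    (Subspace.biUnion_ne_univ_of_top_notMem ht)
  simp only [Set.mem_iUnion, not_exists] at hv
  refine ⟨v, v.2, fun h0 => ?_, fun Q hQ f hf => ?_⟩
  · refine hv ⊥ (Finset.mem_insert_self _ _) ?_
    exact (Submodule.mem_bot K).mpr (Subtype.ext h0)
  · by_contra hfQ
    have h1 : (v : MvPolynomial (Fin n) K) ∈ {r : MvPolynomial (Fin n) K |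
        ∃ x : MvPolynomial (Fin n) K ⧸ Q, x ≠ 0 ∧ r • x = 0} := by
      refine ⟨Ideal.Quotient.mk Q f, fun h0 => hfQ (Ideal.Quotient.eq_zero_iff_mem.mp h0), ?_⟩
      exact Ideal.Quotient.eq_zero_iff_mem.mpr hf
    rw [← biUnion_associatedPrimes_eq_zero_divisors] at h1
    simp only [Set.mem_iUnion] at h1
    obtain ⟨P, hPm, hvP⟩ := h1
    refine hv ((P.restrictScalars K).comap V.subtype) (Finset.mem_insert_of_mem
      (Finset.mem_image.mpr ⟨P, ?_, rfl⟩)) hvP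
    simp only [Set.Finite.mem_toFinset, Set.mem_iUnion]
    exact ⟨Q, hQ, hPm⟩

/-! ### From families to componentwise linear ideals -/

lemma Homog.eq_of_component_eq {I J : Ideal (MvPolynomial (Fin n) K)} (hI : Homog I)
    (hJ : Homog J) (h : ∀ d, component I d = component J d) : I = J := by
  have key : ∀ {I J : Ideal (MvPolynomial (Fin n) K)}, Homog I → Homog J →
      (∀ d, component I d = component J d) → I ≤ J := by
    intro I J hI hJ h f hf
    rw [hJ.mem_iff]
    intro d
    have : homogeneousComponent d f ∈ component J d := h d ▸
      mem_component.mpr ⟨homog_iff.mp hI f hf d, homogeneousComponent_isHomogeneous d f⟩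
    exact (mem_component.mp this).1
  exact le_antisymm (key hI hJ h) (key hJ hI fun d => (h d).symm)

/-- The ideal `⊕_d (E_d)_d` for an increasing sequence of ideals `E_d`. -/
def diagonalIdeal (E : ℕ → Ideal (MvPolynomial (Fin n) K)) (hE : Monotone E) :
    Ideal (MvPolynomial (Fin n) K) where
  carrier := {f | ∀ d, homogeneousComponent d f ∈ E d}
  add_mem' hf hg d := by
    rw [map_add]
    exact (E d).add_mem (hf d) (hg d)
  zero_mem' d := by
    rw [map_zero]
    exact (E d).zero_mem
  smul_mem' a f hf d := by
    rw [smul_eq_mul, ← sum_homogeneousComponent a, Finset.sum_mul, map_sum]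
    refine (E d).sum_mem fun i _ => ?_
    have hi := homogeneousComponent_isHomogeneous i a
    rcases lt_or_ge d i with h | h
    · rw [homogeneousComponent_mul_of_lt hi f h]
      exact (E d).zero_mem
    · obtain ⟨j, rfl⟩ := Nat.exists_eq_add_of_le h
      rw [homogeneousComponent_mul_add hi]
      exact (E _).mul_mem_left _ (hE (Nat.le_add_left j i) (hf j))

lemma mem_diagonalIdeal {E : ℕ → Ideal (MvPolynomial (Fin n) K)} {hE : Monotone E}
    {f : MvPolynomial (Fin n) K} :
    f ∈ diagonalIdeal E hE ↔ ∀ d, homogeneousComponent d f ∈ E d := Iff.rfl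

lemma component_diagonalIdeal {E : ℕ → Ideal (MvPolynomial (Fin n) K)} {hE : Monotone E}
    (d : ℕ) : component (diagonalIdeal E hE) d = component (E d) d := by
  ext f
  rw [mem_component, mem_component, mem_diagonalIdeal]
  refine and_congr_left fun hf => ⟨fun h => ?_, fun h e => ?_⟩
  · have := h d
    rwa [homogeneousComponent_eq_self hf] at this
  · rw [homogeneousComponent_of_mem hf]
    split_ifs with hed
    · rwa [hed]
    · exact (E e).zero_mem

lemma homog_diagonalIdeal {E : ℕ → Ideal (MvPolynomial (Fin n) K)} {hE : Monotone E} :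
    Homog (diagonalIdeal E hE) := by
  rw [homog_iff]
  intro f hf d
  refine ((mem_component (j := d)).mp ?_).1
  rw [component_diagonalIdeal]
  exact mem_component.mpr ⟨hf d, homogeneousComponent_isHomogeneous d f⟩

/-- The sequence `0, …, 0, Q_0, Q_1, …` with `Q_0` in position `d`. -/
def shift (Q : ℕ → Ideal (MvPolynomial (Fin n) K)) (d e : ℕ) : Ideal (MvPolynomial (Fin n) K) :=
  if e < d then ⊥ else Q (e - d)

lemma shift_of_lt (Q : ℕ → Ideal (MvPolynomial (Fin n) K)) {d e : ℕ} (h : e < d) :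
    shift Q d e = ⊥ := if_pos h

lemma shift_add (Q : ℕ → Ideal (MvPolynomial (Fin n) K)) (d j : ℕ) :
    shift Q d (d + j) = Q j := by
  rw [shift, if_neg (by omega), Nat.add_sub_cancel_left]

lemma monotone_shift {Q : ℕ → Ideal (MvPolynomial (Fin n) K)} (hQ : Monotone Q) (d : ℕ) :
    Monotone (shift Q d) := by
  intro e e' he
  rcases lt_or_ge e d with h | h
  · rw [shift_of_lt Q h]
    exact bot_le
  · rw [shift, shift, if_neg h.not_gt, if_neg (h.trans he).not_gt]
    exact hQ (Nat.sub_le_sub_right he d)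

/-- The ideal `⊕_j (Q_j)_{d + j}`. -/
def familyIdeal (Q : ℕ → Ideal (MvPolynomial (Fin n) K)) (hQ : Monotone Q) (d : ℕ) :
    Ideal (MvPolynomial (Fin n) K) :=
  diagonalIdeal (shift Q d) (monotone_shift hQ d)

section familyIdeal

variable {Q : ℕ → Ideal (MvPolynomial (Fin n) K)} (hQ : Monotone Q) (d : ℕ)

lemma homog_familyIdeal : Homog (familyIdeal Q hQ d) :=
  homog_diagonalIdeal

lemma component_familyIdeal_add (j : ℕ) :
    component (familyIdeal Q hQ d) (d + j) = component (Q j) (d + j) := by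
  rw [familyIdeal, component_diagonalIdeal, shift_add]

lemma component_familyIdeal_of_lt {e : ℕ} (he : e < d) :
    component (familyIdeal Q hQ d) e = ⊥ := by
  rw [familyIdeal, component_diagonalIdeal, shift_of_lt Q he]
  exact (Submodule.eq_bot_iff _).mpr fun f hf => by simpa using (mem_component.mp hf).1

lemma restrictScalars_familyIdeal :
    (familyIdeal Q hQ d).restrictScalars K = ⨆ j : ℕ, component (Q j) (d + j) := by
  refine le_antisymm (fun f hf => ?_) (iSup_le fun j f hf => ?_)
  · rw [← sum_homogeneousComponent f]
    refine Submodule.sum_mem _ fun e _ => ?_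
    have he : homogeneousComponent e f ∈ component (familyIdeal Q hQ d) e :=
      mem_component.mpr ⟨homog_iff.mp (homog_familyIdeal hQ d) f hf e,
        homogeneousComponent_isHomogeneous e f⟩
    rcases lt_or_ge e d with h | h
    · rw [component_familyIdeal_of_lt hQ d h, Submodule.mem_bot] at he
      rw [he]
      exact Submodule.zero_mem _
    · obtain ⟨j, rfl⟩ := Nat.exists_eq_add_of_le h
      rw [component_familyIdeal_add] at he
      exact Submodule.mem_iSup_of_mem j he
  · rw [← component_familyIdeal_add hQ] at hf
    exact (mem_component.mp hf).1

lemma familyIdeal_le_pow : familyIdeal Q hQ d ≤ idealOfVars (Fin n) K ^ d := by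
  intro f hf
  rw [(homog_pow_idealOfVars d).mem_iff]
  intro e
  rcases lt_or_ge e d with h | h
  · have he : homogeneousComponent e f ∈ component (familyIdeal Q hQ d) e :=
      mem_component.mpr ⟨homog_iff.mp (homog_familyIdeal hQ d) f hf e,
        homogeneousComponent_isHomogeneous e f⟩
    rw [component_familyIdeal_of_lt hQ d h, Submodule.mem_bot] at he
    rw [he]
    exact Ideal.zero_mem _
  · exact mem_pow_idealOfVars_of_isHomogeneous (homogeneousComponent_isHomogeneous e f) h

lemma componentIdeal_familyIdeal_add (j : ℕ) :
    componentIdeal (familyIdeal Q hQ d) (d + j) = componentIdeal (Q j) (d + j) := by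
  rw [componentIdeal, component_familyIdeal_add, componentIdeal]

end familyIdeal

lemma monotone_of_mem_familiesA {Q : ℕ → Ideal (MvPolynomial (Fin n) K)}
    (h : Q ∈ familiesA K n) : Monotone Q :=
  monotone_nat_of_le_succ h.2.1

lemma saturation_eq_of_mem_familiesA {Q : ℕ → Ideal (MvPolynomial (Fin n) K)}
    (h : Q ∈ familiesA K n) (j : ℕ) : saturation (Q j) = Q j := by
  by_cases hj : Q j = ⊤
  · rw [hj]
    exact top_le_iff.mp (le_saturation ⊤)
  · exact (h.2.2.2 j hj).1

/-- Both $\ell$ and the exponent are uniform in $j$: the range of the family is finite, and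
$\mathfrak m^{\operatorname{reg}(Q_0)}\subseteq Q_0+(\ell)\subseteq Q_j+(\ell)$. -/
lemma exists_isRegularMod_of_mem_familiesA [Infinite K] (hn : 2 ≤ n)
    {Q : ℕ → Ideal (MvPolynomial (Fin n) K)} (h : Q ∈ familiesA K n) :
    ∃ l : MvPolynomial (Fin n) K, l ≠ 0 ∧
      ∀ j, IsRegularMod (Q j) l (regularity (Q 0)) := by
  obtain ⟨N, hN⟩ := h.2.2.1
  have hfin : (Set.range Q).Finite := by
    refine ((Set.finite_Iio N).image Q |>.insert ⊤).subset ?_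
    rintro _ ⟨j, rfl⟩
    rcases lt_or_ge j N with hj | hj
    · exact Or.inr ⟨j, hj, rfl⟩
    · exact Or.inl (hN j hj)
  obtain ⟨l, hl, hl0, hreg⟩ := exists_linear_nonZeroDivisor (by omega) hfin (by
    rintro _ ⟨j, rfl⟩
    exact saturation_eq_of_mem_familiesA h j)
  have hreg' : ∀ j f, l * f ∈ Q j → f ∈ Q j := fun j => hreg (Q j) ⟨j, rfl⟩
  obtain ⟨r, hr⟩ : ∃ r, idealOfVars (Fin n) K ^ r ≤ Q 0 ⊔ Ideal.span {l} := by
    by_cases h0 : Q 0 = ⊤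
    · exact ⟨0, by rw [h0]; exact le_sup_of_le_left le_top⟩
    · exact exists_pow_le_of_ringKrullDim (h.1 0) hl (hreg' 0) (h.2.2.2 0 h0).2
  have hle := IsRegularMod.pow_regularity_le ⟨h.1 0, hl, hreg' 0, hr⟩ hn
  exact ⟨l, hl0, fun j => ⟨h.1 j, hl, hreg' j, hle.trans
    (sup_le_sup_right (monotone_of_mem_familiesA h (Nat.zero_le j)) _)⟩⟩

lemma IsRegularMod.mono_of_le {Q : Ideal (MvPolynomial (Fin n) K)} {l : MvPolynomial (Fin n) K}
    {r r' : ℕ} (h : IsRegularMod Q l r) (hr : r ≤ r') : IsRegularMod Q l r' :=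
  h.mono ((Ideal.pow_le_pow_right hr).trans h.pow_le)

lemma initialDegree_familyIdeal [Infinite K] (hn : 2 ≤ n)
    {Q : ℕ → Ideal (MvPolynomial (Fin n) K)} (h : Q ∈ familiesA K n) {d : ℕ}
    (hd : regularity (Q 0) ≤ d) :
    initialDegree (familyIdeal Q (monotone_of_mem_familiesA h) d) = d := by
  obtain ⟨l, -, hl⟩ := exists_isRegularMod_of_mem_familiesA hn h
  refine initialDegree_eq (familyIdeal_le_pow _ d) ?_
  have := component_familyIdeal_add (monotone_of_mem_familiesA h) d 0
  rw [add_zero] at this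
  rw [this]
  exact ((hl 0).mono_of_le hd).component_ne_bot hn

lemma satFamily_familyIdeal [Infinite K] (hn : 2 ≤ n)
    {Q : ℕ → Ideal (MvPolynomial (Fin n) K)} (h : Q ∈ familiesA K n) {d : ℕ}
    (hd : regularity (Q 0) ≤ d) :
    satFamily (familyIdeal Q (monotone_of_mem_familiesA h) d) = Q := by
  obtain ⟨l, -, hl⟩ := exists_isRegularMod_of_mem_familiesA hn h
  funext j
  rw [satFamily, initialDegree_familyIdeal hn h hd, componentIdeal_familyIdeal_add]
  exact ((hl j).mono_of_le (by omega)).saturation_componentIdeal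

lemma familyIdeal_mem_classC [Infinite K] (hn : 2 ≤ n)
    {Q : ℕ → Ideal (MvPolynomial (Fin n) K)} (h : Q ∈ familiesA K n) {d : ℕ}
    (hd : regularity (Q 0) ≤ d) :
    familyIdeal Q (monotone_of_mem_familiesA h) d ∈ classC K n := by
  obtain ⟨l, hl0, hl⟩ := exists_isRegularMod_of_mem_familiesA hn h
  have hQ := monotone_of_mem_familiesA h
  refine ⟨homog_familyIdeal hQ d, ?_, ⟨l, (hl 0).linear, hl0, ?_⟩, fun e => ?_⟩
  · obtain ⟨N, hN⟩ := h.2.2.1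
    refine finite_of_pow_le (k := d + N) (pow_idealOfVars_le_iff.mpr fun f hf => ?_)
    refine ((mem_component (j := d + N)).mp ?_).1
    rw [component_familyIdeal_add, hN N le_rfl]
    exact mem_component.mpr ⟨Submodule.mem_top, hf⟩
  · rw [initialDegree_familyIdeal hn h hd]
    refine le_antisymm (sup_le_sup_right (familyIdeal_le_pow hQ d) _)
      (sup_le (pow_idealOfVars_le_iff.mpr fun f hf => ?_) le_sup_right)
    obtain ⟨q, hq, g, rfl, hqd, -⟩ := exists_add_mul_of_mem_sup (h.1 0) (hl 0).linear hf
      (((hl 0).mono_of_le hd).pow_le (mem_pow_idealOfVars_of_isHomogeneous hf le_rfl))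
    refine add_mem (Ideal.mem_sup_left ?_) (Ideal.mem_sup_right
      (Ideal.mul_mem_right _ _ (Ideal.mem_span_singleton_self l)))
    have := component_familyIdeal_add hQ d 0
    rw [add_zero] at this
    exact (mem_component.mp (this ▸ mem_component.mpr ⟨hq, hqd⟩)).1
  · rcases lt_or_ge e d with he | he
    · left
      rw [componentIdeal, component_familyIdeal_of_lt hQ d he]
      exact Ideal.span_eq_bot.mpr fun x hx => hx
    · obtain ⟨j, rfl⟩ := Nat.exists_eq_add_of_le he
      rw [componentIdeal_familyIdeal_add]
      exact ((hl j).mono_of_le (by omega)).hasLinearResolution_componentIdeal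

/-! ### From componentwise linear ideals to families -/

/-- Since $\mathfrak m I_d\subseteq I_{\langle d+1\rangle}$, the generators of $I_{\langle
d\rangle}$ lie in the saturation of $I_{\langle d+1\rangle}$. -/
lemma satFamily_le_succ (I : Ideal (MvPolynomial (Fin n) K)) (j : ℕ) :
    satFamily I j ≤ satFamily I (j + 1) := by
  rw [satFamily, satFamily, ← saturation_saturation (componentIdeal I (_ + (j + 1)))]
  refine saturation_mono (Ideal.span_le.mpr fun f hf => mem_saturation.mpr ⟨1, ?_⟩)
  obtain ⟨hfI, hfd⟩ := mem_component.mp hf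
  have hle : idealOfVars (Fin n) K ^ 1 ≤
      (componentIdeal I (initialDegree I + (j + 1))).colon {f} := by
    rw [pow_idealOfVars_le_iff]
    intro u hu
    rw [Submodule.mem_colon_singleton, smul_eq_mul]
    refine component_le_componentIdeal I _ (mem_component.mpr ⟨I.mul_mem_left u hfI, ?_⟩)
    have := hu.mul hfd
    rwa [show 1 + (initialDegree I + j) = initialDegree I + (j + 1) by ring] at this
  intro u hu
  have := hle hu
  rwa [Submodule.mem_colon_singleton, smul_eq_mul] at this

lemma homog_satFamily (I : Ideal (MvPolynomial (Fin n) K)) (j : ℕ) : Homog (satFamily I j) :=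
  (homog_componentIdeal I _).saturation

lemma exists_isRegularMod_satFamily {I : Ideal (MvPolynomial (Fin n) K)}
    (hI : I ∈ classC K n) :
    ∃ l : MvPolynomial (Fin n) K, ∀ j, IsRegularMod (satFamily I j) l (initialDegree I) := by
  obtain ⟨l, hl, -, hIl⟩ := hI.2.2.1
  have h0 : idealOfVars (Fin n) K ^ initialDegree I ≤ satFamily I 0 ⊔ Ideal.span {l} := by
    refine pow_idealOfVars_le_iff.mpr fun f hf => ?_
    have hfI : f ∈ I ⊔ Ideal.span {l} := by
      rw [hIl]
      exact Ideal.mem_sup_left (mem_pow_idealOfVars_of_isHomogeneous hf le_rfl)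
    obtain ⟨q, hq, g, rfl, hqd, -⟩ := exists_add_mul_of_mem_sup hI.1 hl hf hfI
    refine add_mem (Ideal.mem_sup_left ?_) (Ideal.mem_sup_right
      (Ideal.mul_mem_right _ _ (Ideal.mem_span_singleton_self l)))
    exact le_saturation _ (component_le_componentIdeal I _ (mem_component.mpr ⟨hq, hqd⟩))
  refine ⟨l, fun j => ?_⟩
  have hj := h0.trans (sup_le_sup_right
    (monotone_nat_of_le_succ (satFamily_le_succ I) (Nat.zero_le j)) (Ideal.span {l}))
  exact ⟨homog_satFamily I j, hl,
    -- The given $\ell$ is not assumed to be a non-zero-divisor; this follows from saturatedness and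
    -- the inclusion just obtained.
    fun f hf => mem_of_mul_mem_of_saturation_eq (saturation_saturation _) hj hf, hj⟩

lemma component_initialDegree_add_ne_bot {I : Ideal (MvPolynomial (Fin n) K)} (hn : 2 ≤ n)
    (hI : I ∈ classC K n) (j : ℕ) :
    component I (initialDegree I + j) ≠ ⊥ := by
  have := hI.2.1
  obtain ⟨k, hk⟩ := exists_pow_le_of_finite hI.1
  let a : Fin n := ⟨0, by omega⟩
  have hX : ∀ k, (X a ^ k : MvPolynomial (Fin n) K).IsHomogeneous k := fun k => by
    simpa using (isHomogeneous_X K a).pow k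
  have hX0 : ∀ k, (X a ^ k : MvPolynomial (Fin n) K) ≠ 0 := fun k => pow_ne_zero k (X_ne_zero a)
  have hmem : component I (initialDegree I) ≠ ⊥ := by
    refine Nat.sInf_mem (s := {d | component I d ≠ ⊥}) ⟨k, fun h => hX0 k ?_⟩
    have : X a ^ k ∈ component I k :=
      mem_component.mpr ⟨hk (mem_pow_idealOfVars_of_isHomogeneous (hX k) le_rfl), hX k⟩
    rwa [h, Submodule.mem_bot] at this
  obtain ⟨f, hf, hf0⟩ := Submodule.exists_mem_ne_zero_of_ne_bot hmem
  intro h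
  have : f * X a ^ j ∈ component I (initialDegree I + j) :=
    mem_component.mpr ⟨I.mul_mem_right _ (mem_component.mp hf).1, (mem_component.mp hf).2.mul (hX j)⟩
  rw [h, Submodule.mem_bot] at this
  exact mul_ne_zero hf0 (hX0 j) this

lemma component_satFamily {I : Ideal (MvPolynomial (Fin n) K)} (hn : 2 ≤ n)
    (hI : I ∈ classC K n) (j : ℕ) :
    component (satFamily I j) (initialDegree I + j) = component I (initialDegree I + j) := by
  rw [satFamily, component_saturation_componentIdeal (by omega) (hI.2.2.2 _)
    (component_initialDegree_add_ne_bot hn hI j) le_rfl, component_componentIdeal_self]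

lemma satFamily_mem_familiesA {I : Ideal (MvPolynomial (Fin n) K)}
    (hI : I ∈ classC K n) :
    satFamily I ∈ familiesA K n := by
  obtain ⟨l, hl⟩ := exists_isRegularMod_satFamily hI
  refine ⟨homog_satFamily I, satFamily_le_succ I, ?_,
    fun j hj => ⟨saturation_saturation _, (hl j).ringKrullDim_eq_one hj⟩⟩
  have := hI.2.1
  obtain ⟨k, hk⟩ := exists_pow_le_of_finite hI.1
  refine ⟨k, fun j hj => (Ideal.eq_top_iff_one _).mpr
    (mem_saturation.mpr ⟨initialDegree I + j, ?_⟩)⟩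
  have hle : idealOfVars (Fin n) K ^ (initialDegree I + j) ≤
      componentIdeal I (initialDegree I + j) :=
    pow_idealOfVars_le_iff.mpr fun f hf => component_le_componentIdeal I _
      (mem_component.mpr ⟨hk (mem_pow_idealOfVars_of_isHomogeneous hf (by omega)), hf⟩)
  exact fun u hu => Ideal.mul_mem_right _ _ (hle hu)

lemma regularity_satFamily_le {I : Ideal (MvPolynomial (Fin n) K)}
    (hI : I ∈ classC K n) :
    regularity (satFamily I 0) ≤ initialDegree I := by
  obtain ⟨l, hl⟩ := exists_isRegularMod_satFamily hI
  exact (hl 0).regularity_le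

lemma familyIdeal_satFamily {I : Ideal (MvPolynomial (Fin n) K)} (hn : 2 ≤ n)
    (hI : I ∈ classC K n) :
    familyIdeal (satFamily I) (monotone_of_mem_familiesA (satFamily_mem_familiesA hI))
      (initialDegree I) = I := by
  have hQ := monotone_of_mem_familiesA (satFamily_mem_familiesA hI)
  refine (homog_familyIdeal hQ _).eq_of_component_eq hI.1 fun e => ?_
  rcases lt_or_ge e (initialDegree I) with he | he
  · rw [component_familyIdeal_of_lt hQ _ he]
    exact (not_not.mp (Nat.notMem_of_lt_sInf he)).symm
  · obtain ⟨j, rfl⟩ := Nat.exists_eq_add_of_le he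
    rw [component_familyIdeal_add hQ, component_satFamily hn hI]

/-- The bijection between the families with a shift and the componentwise linear ideals. -/
def familiesEquivClassC (K : Type*) [Field K] [Infinite K] (n : ℕ) (hn : 2 ≤ n) :
    (familiesA K n × ℕ) ≃ classC K n where
  toFun p := ⟨familyIdeal p.1 (monotone_of_mem_familiesA p.1.2) (regularity (p.1.1 0) + p.2),
    familyIdeal_mem_classC hn p.1.2 (Nat.le_add_right _ _)⟩
  invFun I := (⟨satFamily I, satFamily_mem_familiesA I.2⟩,
    initialDegree I.1 - regularity (satFamily I.1 0))
  left_inv p := by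
    have h1 := satFamily_familyIdeal hn p.1.2 (Nat.le_add_right (regularity (p.1.1 0)) p.2)
    have h2 := initialDegree_familyIdeal hn p.1.2 (Nat.le_add_right (regularity (p.1.1 0)) p.2)
    refine Prod.ext (Subtype.ext h1) ?_
    dsimp only
    rw [h1, h2, Nat.add_sub_cancel_left]
  right_inv I := by
    refine Subtype.ext ?_
    dsimp only
    have h := familyIdeal_satFamily hn I.2
    -- The subtraction of natural numbers is exact here because $\operatorname{reg}(Q_0(I))\le
    -- o(I)$.
    rwa [← Nat.add_sub_cancel' (regularity_satFamily_le I.2)] at h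

end GradedIdeal

end

theorem mainTheorem8 (K : Type*) [Field K] [Infinite K] (n : ℕ) (hn : 2 ≤ n) :
    ∃ e : (GradedIdeal.familiesA K n × ℕ) ≃ GradedIdeal.classC K n,
      (∀ (Q : GradedIdeal.familiesA K n) (k : ℕ),
        (e (Q, k) : Ideal (MvPolynomial (Fin n) K)).restrictScalars K =
          GradedIdeal.gradedSum (Q : ℕ → Ideal (MvPolynomial (Fin n) K)) k) ∧
      (∀ I : GradedIdeal.classC K n,
        ((e.symm I).1 : ℕ → Ideal (MvPolynomial (Fin n) K)) = GradedIdeal.satFamily I.1 ∧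
        ((e.symm I).2 : ℤ) = (GradedIdeal.initialDegree I.1 : ℤ) -
          (GradedIdeal.regularity (GradedIdeal.satFamily I.1 0) : ℤ)) := by
  refine ⟨GradedIdeal.familiesEquivClassC K n hn, fun Q k => ?_, fun I => ⟨rfl, ?_⟩⟩
  · exact GradedIdeal.restrictScalars_familyIdeal (GradedIdeal.monotone_of_mem_familiesA Q.2) _
  · exact Nat.cast_sub (GradedIdeal.regularity_satFamily_le I.2)
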